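/- Let $\mathbb F$ be a field of characteristic not $2$, let $V$ be a finite-dimensional $\mathbb F$-vector space, and let $G$ be a nontrivial finite cyclic group with a chosen generator $g$, acting linearly on $V$ by $v\mapsto{}^hv$. Put $N=|G|\ge 2$, let $A=S(V)\rtimes G$ be the skew group algebra, with $(s\,h)(s'h')=s\,({}^hs')\,hh'$, and let $\overline{\mathbb FG}=\mathbb FG/(\mathbb F\cdot 1)$. All tensor products are over $\mathbb F$. **The complex $X_\bullet$ (periodic-twisted-Koszul).** $X_n=\bigoplus_{i+j=n}X_{i,j}$ with $X_{i,j}=A\otimes\Lambda^jV\otimes A$, and the differential is $d_P+(-1)^id_K$ on $X_{i,j}$, where $d_P:X_{i,j}\to X_{i-1,j}$ and $d_K:X_{i,j}\to X_{i,j-1}$ are the $A$-bimodule maps with $$d_P(1\otimes y\otimes 1)=\begin{cases} g\otimes y\otimes 1-1\otimes{}^gy\otimes g & i \text{ odd}\\ \sum_{\ell=0}^{N-1} g^{N-1-\ell}\otimes{}^{g^\ell}y\otimes g^\ell & i\ge 2\text{ even,}\end{cases}$$ $$d_K(1\otimes v_1\wedge\dots\wedge v_j\otimes 1)=\sum_{m=1}^{j}(-1)^{m-1}\bigl({}^{h}v_m\otimes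 y_m\otimes 1-1\otimes y_m\otimes v_m\bigr),$$ with $y_m=v_1\wedge\dots\widehat{v_m}\dots\wedge v_j$ and $h=1$ for $i$ even, $h=g$ for $i$ odd. (The maps $d_P$ and $d_K$ are zero on $X_{0,j}$ and $X_{i,0}$ respectively.) **The complex $Y_\bullet$ (reduced-bar-twisted-Koszul).** $Y_n=\bigoplus_{i+j=n}Y_{i,j}$ with $Y_{i,j}=A\otimes\overline{\mathbb FG}^{\otimes i}\otimes\Lambda^jV\otimes A$, and the differential is $d_B+(-1)^id_K$ on $Y_{i,j}$, where $d_B$ and $d_K$ are the $A$-bimodule maps with, for $x_1,\dots,x_i\in G$, $$\begin{aligned}d_B(1\otimes x_1\otimes\dots\otimes x_i\otimes y\otimes 1)={}&x_1\otimes x_2\otimes\dots\otimes x_i\otimes y\otimes 1+\sum_{m=1}^{i-1}(-1)^m\,1\otimes x_1\otimes\dots\otimes x_mx_{m+1}\otimes\dots\otimes x_i\otimes y\otimes 1\\&+(-1)^i\,1\otimes x_1\otimes\dots\otimes x_{i-1}\otimes{}^{x_i}y\otimes x_i,\end{aligned}$$ and $d_K$ given on $1\otimes x_1\otimes\dots\otimes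 x_i\otimes v_1\wedge\dots\wedge v_j\otimes 1$ by the Koszul formula $\sum_{m}(-1)^{m-1}\bigl({}^{h}v_m\otimes x_1\otimes\dots\otimes x_i\otimes y_m\otimes 1-1\otimes x_1\otimes\dots\otimes x_i\otimes y_m\otimes v_m\bigr)$ with $h=x_1\cdots x_i$. (Again $d_B=0$ on $Y_{0,j}$ and $d_K=0$ on $Y_{i,0}$.) **Gradings.** Both complexes carry the polynomial grading in which $V$ has degree $1$, $\Lambda^jV$ has degree $j$ and $G$ has degree $0$, and a $G$-grading: for $r,s\in S(V)$ and $a',a\in G$ the element $ra'\otimes y\otimes sa$ of $X_{i,j}$ has $G$-degree $a'a$ if $i$ is even and $a'ag$ if $i$ is odd, and the element $ra'\otimes x_1\otimes\dots\otimes x_i\otimes y\otimes sa$ of $Y_{i,j}$ has $G$-degree $a'x_1\cdots x_ia$. **Lemma.** There are chain maps of complexes of $A$-bimodules $\iota_\bullet:X_\bullet\to Y_\bullet$ and $\pi_\bullet:Y_\bullet\to X_\bullet$, homogeneous of degree zero for both gradings, with $\pi_n\iota_n=\mathrm{id}_{X_n}$ for all $n\ge 0$. They are given by $\iota_n=\sum_{i+j=n}\iota_{i,j}$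 and $\pi_n=\sum_{i+j=n}\pi_{i,j}$, where $\iota_{i,j}:X_{i,j}\to Y_{i,j}$ and $\pi_{i,j}:Y_{i,j}\to X_{i,j}$ satisfy, for all $y\in\Lambda^jV$: 1. with $\bar\beta=g^{kN-(i_1+\dots+i_k)-k}$, $$\iota_{i,j}(1\otimes y\otimes 1)=\begin{cases}\displaystyle\sum_{i_1,\dots,i_k=1}^{N-1}1\otimes g^{i_k}\otimes g\otimes\dots\otimes g^{i_1}\otimes g\otimes{}^{\bar\beta}y\otimes\bar\beta & i=2k,\\[2ex]\displaystyle\sum_{i_1,\dots,i_k=1}^{N-1}1\otimes g\otimes g^{i_k}\otimes g\otimes\dots\otimes g^{i_1}\otimes g\otimes{}^{\bar\beta}y\otimes\bar\beta & i=2k+1;\end{cases}$$ 2. for all $0\le i_1,\dots,i_i\le N-1$: if $i=2k$, then $$\pi_{i,j}(1\otimes g^{i_1}\otimes\dots\otimes g^{i_i}\otimes y\otimes 1)=1\otimes{}^{\beta}y\otimes\beta,\qquad \beta=\prod_{m=1}^kg^{i_{2m-1}+i_{2m}-N},$$ when $i_{2m-1}+i_{2m}\ge N$ for all $1\le m\le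 k$, and the value is $0$ otherwise; if $i=2k+1$, then $$\pi_{i,j}(1\otimes g^{i_1}\otimes\dots\otimes g^{i_i}\otimes y\otimes 1)=\sum_{\ell=0}^{i_1-1}g^{i_1-1-\ell}\otimes{}^{g^\ell\beta'}y\otimes g^\ell\beta',\qquad \beta'=\prod_{m=1}^kg^{i_{2m}+i_{2m+1}-N},$$ when $i_{2m}+i_{2m+1}\ge N$ for all $1\le m\le k$, and the value is $0$ otherwise. -/

import Mathlib

open scoped TensorProduct DirectSum

set_option linter.unusedSectionVars false

noncomputable section

namespace TwistedKoszul

universe u v w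

variable (F : Type u) (G : Type v) (V : Type w) [Field F] [CommGroup G]
  [AddCommGroup V] [Module F V] [DistribMulAction G V] [SMulCommClass G F V]

/-- The algebra endomorphism of `S(V)` induced by the action of `h` on `V`. -/
def symAct (h : G) : SymmetricAlgebra F V →ₐ[F] SymmetricAlgebra F V :=
  SymmetricAlgebra.lift (SymmetricAlgebra.ι F V ∘ₗ DistribSMul.toLinearMap F V h)

/-- `G` acts on `S(V)` by the algebra automorphisms that extend its linear action on `V`. -/
instance symMulSemiringAction : MulSemiringAction G (SymmetricAlgebra F V) where
  smul h s := symAct F G V h s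
  one_smul s := by
    change symAct F G V 1 s = AlgHom.id F _ s
    congr 1
    apply SymmetricAlgebra.algHom_ext
    ext v
    simp [symAct]
  mul_smul h k s := by
    change symAct F G V (h * k) s = ((symAct F G V h).comp (symAct F G V k)) s
    congr 1
    apply SymmetricAlgebra.algHom_ext
    ext v
    simp [symAct, mul_smul]
  smul_zero h := map_zero (symAct F G V h)
  smul_add h := map_add (symAct F G V h)
  smul_one h := map_one (symAct F G V h)
  smul_mul h := map_mul (symAct F G V h)

instance symSMulCommClass : SMulCommClass G F (SymmetricAlgebra F V) where
  smul_comm h c s := map_smul (symAct F G V h) c s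

/-- The skew group algebra `A = S(V) ⋊ G`, with `(s g)(s' g') = s (ᵍs') (g g')`. -/
def A : Type (max u v w) := SkewMonoidAlgebra (SymmetricAlgebra F V) G

instance : Ring (A F G V) :=
  inferInstanceAs (Ring (SkewMonoidAlgebra (SymmetricAlgebra F V) G))

instance : Algebra F (A F G V) :=
  inferInstanceAs (Algebra F (SkewMonoidAlgebra (SymmetricAlgebra F V) G))

/-- The enveloping algebra `Aᵉ = A ⊗ Aᵒᵖ`.  An `A`-bimodule is a left `Aᵉ`-module. -/
def Ae : Type (max u v w) := A F G V ⊗[F] (A F G V)ᵐᵒᵖ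

instance : Ring (Ae F G V) := inferInstanceAs (Ring (A F G V ⊗[F] (A F G V)ᵐᵒᵖ))

instance : Algebra F (Ae F G V) := inferInstanceAs (Algebra F (A F G V ⊗[F] (A F G V)ᵐᵒᵖ))

variable {F G V} in
/-- The element `s h` of `A`, for `s` in `S(V)` and `h` in `G`. -/
def mon (s : SymmetricAlgebra F V) (h : G) : A F G V := SkewMonoidAlgebra.single h s

/-- The free `A`-bimodule `A ⊗ W ⊗ A` on a vector space `W`, written `Aᵉ ⊗ W`: the element
`a ⊗ w ⊗ b` is `(a ⊗ₜ op b) ⊗ₜ w`. -/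
abbrev FreeBimod (W : Type*) [AddCommGroup W] [Module F W] := Ae F G V ⊗[F] W

variable {F G V}

variable (F G V) in
/-- The element `a ⊗ b` of `Aᵉ`, which acts on a bimodule by `m ↦ a m b`. -/
def lr : A F G V →ₗ[F] A F G V →ₗ[F] Ae F G V :=
  (TensorProduct.mk F (A F G V) (A F G V)ᵐᵒᵖ).compl₂ (MulOpposite.opLinearEquiv F).toLinearMap

variable (F V) in
/-- The group element `h`, as an element of `A`. -/
def grp (h : G) : A F G V := mon 1 h

variable (F G V) in
/-- The inclusion of `V` in `A`. -/
def vec : V →ₗ[F] A F G V where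
  toFun v := mon (SymmetricAlgebra.ι F V v) 1
  map_add' x y := by
    rw [map_add]; exact SkewMonoidAlgebra.single_add _ _ _
  map_smul' c x := by
    rw [map_smul]; exact (SkewMonoidAlgebra.smul_single c _ _).symm

variable (F V) in
/-- The action of `h` on `Λʲ V`. -/
def extAct (j : ℕ) (h : G) : ⋀[F]^j V →ₗ[F] ⋀[F]^j V :=
  exteriorPower.map j (DistribSMul.toLinearMap F V h)

/-- The `A`-bimodule map on `A ⊗ W ⊗ A` with `1 ⊗ w ⊗ 1 ↦ f w`. -/
def extend {W N : Type*} [AddCommGroup W] [Module F W] [AddCommGroup N] [Module F N]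
    [Module (Ae F G V) N] [IsScalarTower F (Ae F G V) N] [SMulCommClass F (Ae F G V) N]
    (f : W →ₗ[F] N) : FreeBimod F G V W →ₗ[Ae F G V] N :=
  TensorProduct.AlgebraTensorModule.lift (LinearMap.toSpanSingleton (Ae F G V) (W →ₗ[F] N) f)

variable {W W' : Type*} [AddCommGroup W] [Module F W] [AddCommGroup W'] [Module F W']

variable (F V) in
/-- `v ↦ (ʰv) ⊗ 1 - 1 ⊗ v` in `Aᵉ`. -/
def koszulCoeff (h : G) : V →ₗ[F] Ae F G V :=
  (lr F G V).flip 1 ∘ₗ vec F G V ∘ₗ DistribSMul.toLinearMap F V h - lr F G V 1 ∘ₗ vec F G V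

section Koszul

variable {N : Type*} [AddCommGroup N] [Module F N] [Module (Ae F G V) N]
  [IsScalarTower F (Ae F G V) N] [SMulCommClass F (Ae F G V) N]

/-- The map `(v, y) ↦ c(v) • R y`, linear in `v` and alternating in the entries of `y`. -/
def koszulAux {j : ℕ} (c : V →ₗ[F] Ae F G V) (R : ⋀[F]^j V →ₗ[F] N) :
    V →ₗ[F] V [⋀^Fin j]→ₗ[F] N where
  toFun v := (DistribSMul.toLinearMap F N (c v) ∘ₗ R).compAlternatingMap
    (exteriorPower.ιMulti F j)
  map_add' v v' := by ext; simp [add_smul]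
  map_smul' a v := by ext; simp

/-- The linear map with
`v₀ ∧ ⋯ ∧ vⱼ ↦ ∑ₖ (-1)ᵏ c(vₖ) • R(v₀ ∧ ⋯ ∧ v̂ₖ ∧ ⋯ ∧ vⱼ)`. -/
def koszul {j : ℕ} (c : V →ₗ[F] Ae F G V) (R : ⋀[F]^j V →ₗ[F] N) : ⋀[F]^(j + 1) V →ₗ[F] N :=
  exteriorPower.alternatingMapLinearEquiv (AlternatingMap.alternatizeUncurryFin (koszulAux c R))

/-- The linear map `y ↦ a' • R (ᵃy) • a`. -/
def twist {j : ℕ} (a' a : G) (R : ⋀[F]^j V →ₗ[F] N) : ⋀[F]^j V →ₗ[F] N :=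
  DistribSMul.toLinearMap F N (lr F G V (grp F V a') (grp F V a)) ∘ₗ R ∘ₗ extAct F V j a

theorem koszul_ιMulti {j : ℕ} (c : V →ₗ[F] Ae F G V) (R : ⋀[F]^j V →ₗ[F] N)
    (v : Fin (j + 1) → V) :
    koszul c R (exteriorPower.ιMulti F (j + 1) v) =
      ∑ k : Fin (j + 1), (-1 : ℤ) ^ (k : ℕ) •
        (c (v k) • R (exteriorPower.ιMulti F j (k.removeNth v))) := by
  simp [koszul, AlternatingMap.alternatizeUncurryFin_apply, koszulAux]

theorem twist_apply {j : ℕ} (a' a : G) (R : ⋀[F]^j V →ₗ[F] N) (y : ⋀[F]^j V) :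
    twist a' a R y = lr F G V (grp F V a') (grp F V a) • R (extAct F V j a y) := rfl

theorem lr_mul (a b a' b' : A F G V) :
    lr F G V a b * lr F G V a' b' = lr F G V (a * a') (b' * b) :=
  Algebra.TensorProduct.tmul_mul_tmul _ _ _ _

theorem mon_mul (s s' : SymmetricAlgebra F V) (h h' : G) :
    mon s h * mon s' h' = mon (s * h • s') (h * h') :=
  SkewMonoidAlgebra.single_mul_single

theorem grp_mul (h h' : G) : grp F V h * grp F V h' = grp F V (h * h') := by
  simp [grp, mon_mul]

theorem grp_one : grp F V (1 : G) = 1 := rfl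

theorem smul_ι (h : G) (v : V) :
    h • SymmetricAlgebra.ι F V v = SymmetricAlgebra.ι F V (h • v) := by
  change symAct F G V h _ = _
  simp [symAct]

theorem grp_mul_vec (h : G) (v : V) :
    grp F V h * vec F G V v = vec F G V (h • v) * grp F V h := by
  simp [grp, vec, mon_mul, smul_ι]

theorem vec_mul_vec (v w : V) :
    vec F G V v * vec F G V w = vec F G V w * vec F G V v := by
  simp [vec, mon_mul, mul_comm]

theorem koszulCoeff_apply (h : G) (v : V) :
    koszulCoeff F V h v = lr F G V (vec F G V (h • v)) 1 - lr F G V 1 (vec F G V v) := rfl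

theorem koszulCoeff_comm (h : G) (v w : V) :
    koszulCoeff F V h v * koszulCoeff F V h w = koszulCoeff F V h w * koszulCoeff F V h v := by
  simp only [koszulCoeff_apply, sub_mul, mul_sub, lr_mul, one_mul, mul_one, vec_mul_vec (h • w),
    vec_mul_vec w]
  abel

theorem koszulCoeff_mul_lr (a' h a : G) (v : V) :
    koszulCoeff F V (a' * h * a) v * lr F G V (grp F V a') (grp F V a) =
      lr F G V (grp F V a') (grp F V a) * koszulCoeff F V h (a • v) := by
  simp only [koszulCoeff_apply, sub_mul, mul_sub, lr_mul, one_mul, mul_one, grp_mul_vec,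
    mul_smul]

theorem extAct_mul (j : ℕ) (a b : G) (y : ⋀[F]^j V) :
    extAct F V j (a * b) y = extAct F V j a (extAct F V j b y) := by
  unfold extAct
  rw [← LinearMap.comp_apply, ← exteriorPower.map_comp]
  congr 2
  ext v
  simp [mul_smul]

theorem extAct_one (j : ℕ) (y : ⋀[F]^j V) : extAct F V j (1 : G) y = y := by
  unfold extAct
  have : DistribSMul.toLinearMap F V (1 : G) = LinearMap.id := by ext; simp
  rw [this, exteriorPower.map_id]; rfl

theorem extAct_ιMulti (j : ℕ) (a : G) (v : Fin j → V) :
    extAct F V j a (exteriorPower.ιMulti F j v) = exteriorPower.ιMulti F j (fun k => a • v k) := by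
  unfold extAct
  rw [exteriorPower.map_apply_ιMulti]
  rfl

theorem twist_one {j : ℕ} (R : ⋀[F]^j V →ₗ[F] N) : twist (1 : G) 1 R = R := by
  ext y
  have : lr F G V (1 : A F G V) 1 = 1 := rfl
  simp [twist, extAct_one, grp_one, this]

theorem twist_twist {j : ℕ} (a' a b' b : G) (R : ⋀[F]^j V →ₗ[F] N) :
    twist a' a (twist b' b R) = twist (a' * b') (b * a) R := by
  refine LinearMap.ext fun y => ?_
  simp [twist_apply, smul_smul, lr_mul, grp_mul, extAct_mul]

theorem twist_sum {j : ℕ} {ι : Type*} (s : Finset ι) (a' a : G) (R : ι → ⋀[F]^j V →ₗ[F] N) :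
    twist a' a (∑ i ∈ s, R i) = ∑ i ∈ s, twist a' a (R i) := by
  refine LinearMap.ext fun y => ?_
  simp [twist_apply, Finset.smul_sum]

theorem twist_zsmul {j : ℕ} (n : ℤ) (a' a : G) (R : ⋀[F]^j V →ₗ[F] N) :
    twist a' a (n • R) = n • twist a' a R := by
  refine LinearMap.ext fun y => ?_
  simp [twist_apply, smul_comm n]

theorem koszul_sum {j : ℕ} {ι : Type*} (s : Finset ι) (c : V →ₗ[F] Ae F G V)
    (R : ι → ⋀[F]^j V →ₗ[F] N) :
    koszul c (∑ i ∈ s, R i) = ∑ i ∈ s, koszul c (R i) := by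
  refine exteriorPower.linearMap_ext ?_
  ext v
  simp [koszul_ιMulti, Finset.smul_sum]
  rw [Finset.sum_comm]

theorem koszul_zsmul {j : ℕ} (n : ℤ) (c : V →ₗ[F] Ae F G V) (R : ⋀[F]^j V →ₗ[F] N) :
    koszul c (n • R) = n • koszul c R := by
  refine exteriorPower.linearMap_ext ?_
  ext v
  simp [koszul_ιMulti, Finset.smul_sum, smul_comm n]

theorem koszul_zero {j : ℕ} (c : V →ₗ[F] Ae F G V) :
    koszul c (0 : ⋀[F]^j V →ₗ[F] N) = 0 := by
  simpa using koszul_zsmul 0 c (0 : ⋀[F]^j V →ₗ[F] N)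

theorem koszul_twist {j : ℕ} (a' h a : G) (R : ⋀[F]^j V →ₗ[F] N) :
    koszul (koszulCoeff F V (a' * h * a)) (twist a' a R) =
      twist a' a (koszul (koszulCoeff F V h) R) := by
  refine exteriorPower.linearMap_ext ?_
  ext v
  simp only [LinearMap.compAlternatingMap_apply, koszul_ιMulti, twist_apply, extAct_ιMulti,
    Finset.smul_sum, smul_smul, koszulCoeff_mul_lr, smul_comm (_ : Ae F G V) (_ : ℤ)]
  rfl

theorem koszul_koszul {j : ℕ} (h : G) (R : ⋀[F]^j V →ₗ[F] N) :
    koszul (koszulCoeff F V h) (koszul (koszulCoeff F V h) R) = 0 := by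
  set c := koszulCoeff F V h with hc
  let f : V →ₗ[F] V →ₗ[F] V [⋀^Fin j]→ₗ[F] N :=
    { toFun := fun v => koszulAux c (DistribSMul.toLinearMap F N (c v) ∘ₗ R)
      map_add' := fun v w => by ext; simp [koszulAux, add_smul]
      map_smul' := fun a v => by ext; simp [koszulAux, smul_comm a] }
  have hf : ∀ x y, f x y = f y x := by
    intro x y
    ext v
    simp [f, koszulAux, smul_smul, hc, koszulCoeff_comm h x y]
  have := AlternatingMap.alternatizeUncurryFin_alternatizeUncurryFinLM_comp_of_symmetric hf
  refine exteriorPower.linearMap_ext ?_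
  rw [show (0 : ⋀[F]^(j + 2) V →ₗ[F] N).compAlternatingMap (exteriorPower.ιMulti F (j + 2)) = 0
    by ext; simp, ← this]
  ext v
  simp only [LinearMap.compAlternatingMap_apply, koszul_ιMulti,
    AlternatingMap.alternatizeUncurryFin_apply, LinearMap.comp_apply,
    AlternatingMap.alternatizeUncurryFinLM_apply]
  simp only [f, koszulAux, LinearMap.coe_mk, AddHom.coe_mk, LinearMap.compAlternatingMap_apply,
    LinearMap.comp_apply, DistribSMul.toLinearMap_apply, Finset.smul_sum]
  refine Finset.sum_congr rfl fun k _ => Finset.sum_congr rfl fun l _ => ?_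
  simp only [smul_smul, smul_comm (_ : Ae F G V) (_ : ℤ), hc,
    koszulCoeff_comm h (v k)]

variable {N' : Type*} [AddCommGroup N'] [Module F N'] [Module (Ae F G V) N']
  [IsScalarTower F (Ae F G V) N'] [SMulCommClass F (Ae F G V) N']

theorem map_koszul {j : ℕ} (D : N →ₗ[Ae F G V] N') (c : V →ₗ[F] Ae F G V)
    (R : ⋀[F]^j V →ₗ[F] N) :
    D.restrictScalars F ∘ₗ koszul c R = koszul c (D.restrictScalars F ∘ₗ R) := by
  refine exteriorPower.linearMap_ext ?_
  ext v
  simp [koszul_ιMulti]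

theorem map_twist {j : ℕ} (D : N →ₗ[Ae F G V] N') (a' a : G) (R : ⋀[F]^j V →ₗ[F] N) :
    D.restrictScalars F ∘ₗ twist a' a R = twist a' a (D.restrictScalars F ∘ₗ R) := by
  refine LinearMap.ext fun y => ?_
  simp [twist_apply]

end Koszul

section Total

variable {R : Type*} [Ring R] (M : ℕ → ℕ → Type*) [∀ i j, AddCommGroup (M i j)]
  [∀ i j, Module R (M i j)]

/-- The degree `n` part `⨁_{i+j=n} M i j` of the total complex. -/
abbrev Tot (n : ℕ) := ⨁ p : {p : ℕ × ℕ // p.1 + p.2 = n}, M p.1.1 p.1.2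

variable {M}

/-- The inclusion of the summand `M i j` in degree `n = i + j`. -/
def Tot.incl {i j n : ℕ} (h : i + j = n) : M i j →ₗ[R] Tot M n :=
  DirectSum.lof R {p : ℕ × ℕ // p.1 + p.2 = n} (fun p => M p.1.1 p.1.2) ⟨(i, j), h⟩

/-- The horizontal part of the total differential on the summand `M i j`. -/
def Tot.horiz (dh : ∀ i j, M (i + 1) j →ₗ[R] M i j) {n : ℕ} :
    ∀ i j : ℕ, i + j = n + 1 → (M i j →ₗ[R] Tot M n)
  | 0, _, _ => 0
  | i + 1, j, h => Tot.incl (show i + j = n by omega) ∘ₗ dh i j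

/-- The vertical part of the total differential on the summand `M i j`, without sign. -/
def Tot.vert (dv : ∀ i j, M i (j + 1) →ₗ[R] M i j) {n : ℕ} :
    ∀ i j : ℕ, i + j = n + 1 → (M i j →ₗ[R] Tot M n)
  | _, 0, _ => 0
  | i, j + 1, h => Tot.incl (show i + j = n by omega) ∘ₗ dv i j

/-- The total differential, `dh + (-1)ⁱ dv` on the summand `M i j`. -/
def Tot.d (dh : ∀ i j, M (i + 1) j →ₗ[R] M i j) (dv : ∀ i j, M i (j + 1) →ₗ[R] M i j) (n : ℕ) :
    Tot M (n + 1) →ₗ[R] Tot M n :=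
  DirectSum.toModule R _ _ fun p =>
    Tot.horiz dh p.1.1 p.1.2 p.2 + (-1 : ℤ) ^ p.1.1 • Tot.vert dv p.1.1 p.1.2 p.2

theorem Tot.d_incl (dh : ∀ i j, M (i + 1) j →ₗ[R] M i j) (dv : ∀ i j, M i (j + 1) →ₗ[R] M i j)
    {i j n : ℕ} (h : i + j = n + 1) :
    Tot.d dh dv n ∘ₗ Tot.incl h = Tot.horiz dh i j h + (-1 : ℤ) ^ i • Tot.vert dv i j h :=
  LinearMap.ext fun x => DirectSum.toModule_lof R (ι := {p : ℕ × ℕ // p.1 + p.2 = n + 1})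
    (M := fun p => M p.1.1 p.1.2) (φ := fun p =>
      Tot.horiz dh p.1.1 p.1.2 p.2 + (-1 : ℤ) ^ p.1.1 • Tot.vert dv p.1.1 p.1.2 p.2) ⟨(i, j), h⟩ x

theorem Tot.d_comp_d (dh : ∀ i j, M (i + 1) j →ₗ[R] M i j)
    (dv : ∀ i j, M i (j + 1) →ₗ[R] M i j)
    (hh : ∀ i j, dh i j ∘ₗ dh (i + 1) j = 0) (vv : ∀ i j, dv i j ∘ₗ dv i (j + 1) = 0)
    (hv : ∀ i j, dh i j ∘ₗ dv (i + 1) j = dv i j ∘ₗ dh i (j + 1)) (n : ℕ) :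
    Tot.d dh dv n ∘ₗ Tot.d dh dv (n + 1) = 0 := by
  have key : ∀ i j (h : i + j = n + 2),
      (Tot.d dh dv n ∘ₗ Tot.d dh dv (n + 1)) ∘ₗ Tot.incl (M := M) h = 0 := by
    intro i j h
    have hc : ∀ {i j i' j' : ℕ} (h : i' + j' = n + 1) (f : M i j →ₗ[R] M i' j'),
        Tot.d dh dv n ∘ₗ (Tot.incl h ∘ₗ f) =
          Tot.horiz dh i' j' h ∘ₗ f + (-1 : ℤ) ^ i' • (Tot.vert dv i' j' h ∘ₗ f) := by
      intro i j i' j' h f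
      rw [← LinearMap.comp_assoc, Tot.d_incl, LinearMap.add_comp, LinearMap.smul_comp]
    rw [LinearMap.comp_assoc, Tot.d_incl, LinearMap.comp_add, LinearMap.comp_smul]
    match i, j, h with
    | 0, 0, h => omega
    | 0, 1, h => omega
    | 1, 0, h => omega
    | 0, j + 2, h =>
      simp only [Tot.horiz, Tot.vert, hc, LinearMap.comp_assoc, vv]
      simp
    | i + 2, 0, h =>
      simp only [Tot.horiz, Tot.vert, hc, LinearMap.comp_assoc, hh]
      simp
    | 1, 1, h =>
      simp only [Tot.horiz, Tot.vert, hc, LinearMap.comp_assoc, hv]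
      simp
    | 1, j + 2, h =>
      simp only [Tot.horiz, Tot.vert, hc, LinearMap.comp_assoc, hv, vv]
      simp
    | i + 2, 1, h =>
      simp only [Tot.horiz, Tot.vert, hc, LinearMap.comp_assoc, hv, hh]
      simp [pow_succ]
    | i + 2, j + 2, h =>
      simp only [Tot.horiz, Tot.vert, hc, LinearMap.comp_assoc, hv, hh, vv]
      simp [pow_succ]
  refine DirectSum.linearMap_ext R fun p => ?_
  exact key p.1.1 p.1.2 p.2

end Total

section Periodic

variable (F G V) in
/-- The `A`-bimodule `X_{i,j} = P_i ⊗ K_j ≅ A ⊗ Λʲ V ⊗ A`. -/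
abbrev X (_i j : ℕ) : Type (max u v w) := FreeBimod F G V (⋀[F]^j V)

/-- `y ↦ 1 ⊗ y ⊗ 1` in `X_{i,j}`. -/
def X.gen (i j : ℕ) : ⋀[F]^j V →ₗ[F] X F G V i j := TensorProduct.mk F (Ae F G V) (⋀[F]^j V) 1

/-- The element `a' ⊗ ᵃy ⊗ a` of `X_{i,j}`, which corresponds to `(a' ⊗ a) ⊗ (1 ⊗ y ⊗ 1)` in
`P_i ⊗ K_j`. -/
def X.elt (i j : ℕ) (a' a : G) : ⋀[F]^j V →ₗ[F] X F G V i j := twist a' a (X.gen i j)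

variable (F V) in
/-- The differential `d_P ⊗ id : X_{i+1,j} → X_{i,j}`, where `d_P` is `g ⊗ 1 - 1 ⊗ g` for even `i`
and `∑ₗ g^(|G|-1-l) ⊗ gˡ` for odd `i`. -/
def X.dP (g : G) (i j : ℕ) : X F G V (i + 1) j →ₗ[Ae F G V] X F G V i j :=
  extend (if Even i then X.elt i j g 1 - X.elt i j 1 g
    else ∑ l ∈ Finset.range (Nat.card G), X.elt i j (g ^ (Nat.card G - 1 - l)) (g ^ l))

variable (F V) in
/-- The differential `id ⊗ d_K : X_{i,j+1} → X_{i,j}`.  The element `1 ⊗ 1` of `P_i` has `G`-degree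
`h = 1` for even `i` and `h = g` for odd `i`, so that the factor `v ⊗ 1 - 1 ⊗ v` of the Koszul
differential becomes `ʰv ⊗ 1 - 1 ⊗ v`. -/
def X.dK (g : G) (i j : ℕ) : X F G V i (j + 1) →ₗ[Ae F G V] X F G V i j :=
  extend (koszul (koszulCoeff F V (if Even i then 1 else g)) (X.gen i j))

theorem X.ext {N : Type*} [AddCommGroup N] [Module F N] [Module (Ae F G V) N]
    [IsScalarTower F (Ae F G V) N] (i j : ℕ) {D D' : X F G V i j →ₗ[Ae F G V] N}
    (h : D.restrictScalars F ∘ₗ X.gen i j = D'.restrictScalars F ∘ₗ X.gen i j) : D = D' := by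
  refine TensorProduct.AlgebraTensorModule.ext fun a y => ?_
  have := congrArg (fun z => a • z) (LinearMap.congr_fun h y)
  simpa [X.gen, ← map_smul, TensorProduct.smul_tmul'] using this

theorem extend_comp_mk {W N : Type*} [AddCommGroup W] [Module F W] [AddCommGroup N] [Module F N]
    [Module (Ae F G V) N] [IsScalarTower F (Ae F G V) N] [SMulCommClass F (Ae F G V) N]
    (f : W →ₗ[F] N) :
    (extend f).restrictScalars F ∘ₗ TensorProduct.mk F (Ae F G V) W 1 = f := by
  ext x
  change (1 : Ae F G V) • f x = f x
  rw [one_smul]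

theorem X.dP_gen (g : G) (i j : ℕ) :
    (X.dP F V g i j).restrictScalars F ∘ₗ X.gen (i + 1) j =
      if Even i then X.elt i j g 1 - X.elt i j 1 g
      else ∑ l ∈ Finset.range (Nat.card G), X.elt i j (g ^ (Nat.card G - 1 - l)) (g ^ l) :=
  extend_comp_mk _

theorem X.dK_gen (g : G) (i j : ℕ) :
    (X.dK F V g i j).restrictScalars F ∘ₗ X.gen i (j + 1) =
      koszul (koszulCoeff F V (if Even i then 1 else g)) (X.gen i j) :=
  extend_comp_mk _

theorem comp_sum' {ι U N N' : Type*} [AddCommGroup U] [Module F U] [AddCommGroup N] [Module F N]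
    [AddCommGroup N'] [Module F N'] (s : Finset ι) (D : N →ₗ[F] N') (f : ι → U →ₗ[F] N) :
    D ∘ₗ (∑ i ∈ s, f i) = ∑ i ∈ s, D ∘ₗ f i := by
  ext x; simp

theorem X.sum_shift [Finite G] (g : G) (i j : ℕ) :
    ∑ l ∈ Finset.range (Nat.card G),
      twist (g ^ (Nat.card G - 1 - l + 1)) (g ^ l) (X.gen (F := F) (G := G) (V := V) i j) =
    ∑ l ∈ Finset.range (Nat.card G),
      twist (g ^ (Nat.card G - 1 - l)) (g ^ (l + 1)) (X.gen (F := F) (G := G) (V := V) i j) := by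
  have hN : g ^ Nat.card G = 1 := pow_card_eq_one'
  have hpos : 0 < Nat.card G := Nat.card_pos
  obtain ⟨n, hn⟩ := Nat.exists_eq_succ_of_ne_zero hpos.ne'
  rw [hn, Finset.sum_range_succ', Finset.sum_range_succ]
  congr 1
  · refine Finset.sum_congr rfl fun l hl => ?_
    have hl := Finset.mem_range.1 hl
    rw [show n.succ - 1 - (l + 1) + 1 = n.succ - 1 - l by omega]
  · rw [show n.succ - 1 - 0 + 1 = n.succ by omega, show n.succ - 1 - n = 0 by omega,
      show n + 1 = n.succ from rfl, ← hn, hN, pow_zero]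

theorem twist_sub {N : Type*} [AddCommGroup N] [Module F N] [Module (Ae F G V) N]
    [IsScalarTower F (Ae F G V) N] [SMulCommClass F (Ae F G V) N] {j : ℕ}
    (a b : G) (R R' : ⋀[F]^j V →ₗ[F] N) :
    twist a b (R - R') = twist a b R - twist a b R' := by
  refine LinearMap.ext fun y => ?_
  simp [twist_apply, smul_sub]

theorem X.dP_comp_dP [Finite G] (g : G) (i j : ℕ) :
    X.dP F V g i j ∘ₗ X.dP F V g (i + 1) j = 0 := by
  apply X.ext
  change (X.dP F V g i j).restrictScalars F ∘ₗ
    ((X.dP F V g (i + 1) j).restrictScalars F ∘ₗ X.gen (i + 2) j) = 0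
  rw [X.dP_gen]
  by_cases hi : Even i
  · have hi' : ¬ Even (i + 1) := by simpa [Nat.even_add_one] using hi
    rw [if_neg hi', comp_sum']
    simp only [X.elt, map_twist, X.dP_gen, if_pos hi, twist_sub, twist_twist, one_mul, mul_one,
      ← pow_succ, ← pow_succ']
    refine LinearMap.ext fun y => ?_
    have := LinearMap.congr_fun (X.sum_shift (F := F) (V := V) g i j) y
    rw [LinearMap.sum_apply, LinearMap.sum_apply, ← sub_eq_zero, ← Finset.sum_sub_distrib] at this
    rw [LinearMap.sum_apply]
    exact this
  · have hi' : Even (i + 1) := by simpa [Nat.even_add_one] using hi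
    rw [if_pos hi', LinearMap.comp_sub]
    simp only [X.elt, map_twist, X.dP_gen, if_neg hi, twist_sum, twist_twist, one_mul, mul_one,
      ← pow_succ, ← pow_succ']
    rw [X.sum_shift]
    exact LinearMap.ext fun y => sub_self _

theorem X.dK_comp_dK (g : G) (i j : ℕ) :
    X.dK F V g i j ∘ₗ X.dK F V g i (j + 1) = 0 := by
  apply X.ext
  change (X.dK F V g i j).restrictScalars F ∘ₗ ((X.dK F V g i (j + 1)).restrictScalars F ∘ₗ X.gen i (j + 2)) = 0
  rw [X.dK_gen, map_koszul, X.dK_gen, koszul_koszul]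

theorem koszul_sub {N : Type*} [AddCommGroup N] [Module F N] [Module (Ae F G V) N]
    [IsScalarTower F (Ae F G V) N] [SMulCommClass F (Ae F G V) N] {j : ℕ}
    (c : V →ₗ[F] Ae F G V) (R R' : ⋀[F]^j V →ₗ[F] N) :
    koszul c (R - R') = koszul c R - koszul c R' := by
  refine exteriorPower.linearMap_ext ?_
  ext v
  simp [koszul_ιMulti, smul_sub]

theorem X.dP_comp_dK [Finite G] (g : G) (i j : ℕ) :
    X.dP F V g i j ∘ₗ X.dK F V g (i + 1) j = X.dK F V g i j ∘ₗ X.dP F V g i (j + 1) := by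
  apply X.ext
  have hN : g ^ Nat.card G = 1 := pow_card_eq_one'
  have hpos : 0 < Nat.card G := Nat.card_pos
  change (X.dP F V g i j).restrictScalars F ∘ₗ ((X.dK F V g (i + 1) j).restrictScalars F ∘ₗ X.gen (i + 1) (j + 1)) =
    (X.dK F V g i j).restrictScalars F ∘ₗ ((X.dP F V g i (j + 1)).restrictScalars F ∘ₗ X.gen (i + 1) (j + 1))
  rw [X.dK_gen, map_koszul, X.dP_gen, X.dP_gen]
  by_cases hi : Even i
  · have hi' : ¬ Even (i + 1) := by simpa [Nat.even_add_one] using hi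
    rw [if_neg hi', if_pos hi, if_pos hi, LinearMap.comp_sub, koszul_sub]
    simp only [X.elt, map_twist, X.dK_gen, if_pos hi, ← koszul_twist, mul_one, one_mul]
  · have hi' : Even (i + 1) := by simpa [Nat.even_add_one] using hi
    rw [if_pos hi', if_neg hi, if_neg hi, comp_sum', koszul_sum]
    simp only [X.elt, map_twist, X.dK_gen, if_neg hi, ← koszul_twist]
    refine Finset.sum_congr rfl fun l hl => ?_
    have hl := Finset.mem_range.1 hl
    rw [← pow_succ, ← pow_add, show Nat.card G - 1 - l + 1 + l = Nat.card G by omega, hN]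

end Periodic

section Bar

variable (F G) in
/-- The quotient `FG / (F · 1)`. -/
abbrev RedGroupAlg : Type (max u v) :=
  MonoidAlgebra F G ⧸ Submodule.span F {(1 : MonoidAlgebra F G)}

variable (F) in
/-- The class of the group element `x` in `FG / (F · 1)`. -/
def cls (x : G) : RedGroupAlg F G := Submodule.Quotient.mk (MonoidAlgebra.of F G x)

theorem cls_one : cls F (1 : G) = 0 := by
  rw [cls, map_one, Submodule.Quotient.mk_eq_zero]
  exact Submodule.mem_span_singleton_self _

variable (F G) in
/-- The coordinates at the non-identity elements of `G`. -/
def redCoord : RedGroupAlg F G →ₗ[F] ({x : G // x ≠ 1} →₀ F) :=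
  Submodule.liftQ _
    (Finsupp.lcomapDomain Subtype.val Subtype.val_injective ∘ₗ
      (MonoidAlgebra.coeffLinearEquiv F : MonoidAlgebra F G ≃ₗ[F] (G →₀ F)).toLinearMap) (by
    rw [Submodule.span_le, Set.singleton_subset_iff]
    ext ⟨x, hx⟩
    simp [Finsupp.lcomapDomain, MonoidAlgebra.one_def])

theorem redCoord_cls (x : {x : G // x ≠ 1}) : redCoord F G (cls F x) = Finsupp.single x 1 := by
  classical
  ext y
  simp [redCoord, cls, Finsupp.lcomapDomain, MonoidAlgebra.of, Finsupp.single_apply, Subtype.ext_iff]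

variable (F G) in
/-- The classes of the non-identity elements form a basis of `FG / (F · 1)`. -/
def redBasis : Module.Basis {x : G // x ≠ 1} F (RedGroupAlg F G) :=
  .ofRepr (LinearEquiv.ofLinearMap (redCoord F G) (Finsupp.linearCombination F fun x => cls F x.1)
    (by
      ext x : 2
      simp [redCoord_cls])
    (by
      classical
      refine Submodule.linearMap_qext _ (MonoidAlgebra.lhom_ext' fun x => LinearMap.ext_ring ?_)
      change Finsupp.linearCombination F _ (redCoord F G (cls F x)) = cls F x
      by_cases hx : x = 1
      · rw [hx, cls_one, map_zero, map_zero]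
      · rw [redCoord_cls ⟨x, hx⟩]; simp))

theorem redBasis_apply (x : {x : G // x ≠ 1}) : redBasis F G x = cls F x.1 := by
  simp [redBasis]

variable (F G) in
/-- The tensor power `(FG / (F · 1))^{⊗ i}`. -/
def Bar (i : ℕ) : Type (max u v) := ⨂[F] _ : Fin i, RedGroupAlg F G

instance (i : ℕ) : AddCommGroup (Bar F G i) :=
  inferInstanceAs (AddCommGroup (⨂[F] _ : Fin i, RedGroupAlg F G))

instance (i : ℕ) : Module F (Bar F G i) :=
  inferInstanceAs (Module F (⨂[F] _ : Fin i, RedGroupAlg F G))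

variable (F G) in
/-- The tensors `x₁ ⊗ ⋯ ⊗ xᵢ` of classes of non-identity elements form a basis. -/
def barBasis (i : ℕ) : Module.Basis (Fin i → {x : G // x ≠ 1}) F (Bar F G i) :=
  Basis.piTensorProduct fun _ : Fin i => redBasis F G

variable (F) in
/-- The tensor `x₁ ⊗ ⋯ ⊗ xᵢ` in `(FG / (F · 1))^{⊗ i}`. -/
def bar {i : ℕ} (x : Fin i → G) : Bar F G i := PiTensorProduct.tprod F fun m => cls F (x m)

theorem bar_eq_zero {i : ℕ} (x : Fin i → G) (m : Fin i) (hm : x m = 1) : bar F x = 0 := by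
  refine MultilinearMap.map_coord_zero (PiTensorProduct.tprod F) m ?_
  rw [hm, cls_one]

theorem barBasis_apply (i : ℕ) (p : Fin i → {x : G // x ≠ 1}) :
    barBasis F G i p = bar F fun m => (p m).1 := by
  refine (Basis.piTensorProduct_apply _ _).trans ?_
  simp only [redBasis_apply]
  rfl

/-- The linear map on `(FG / (F · 1))^{⊗ i} ⊗ U` with `(x₁ ⊗ ⋯ ⊗ xᵢ) ⊗ y ↦ f x y` for all
non-identity elements `x₁, …, xᵢ` of `G`. -/
def onTuples {i : ℕ} {U N : Type*} [AddCommGroup U] [Module F U] [AddCommGroup N] [Module F N]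
    (f : (Fin i → G) → U →ₗ[F] N) : Bar F G i ⊗[F] U →ₗ[F] N :=
  TensorProduct.lift
    ((barBasis F G i).constr F fun x => f fun m => (x m).1)

theorem onTuples_bar {i : ℕ} {U N : Type*} [AddCommGroup U] [Module F U] [AddCommGroup N]
    [Module F N] (f : (Fin i → G) → U →ₗ[F] N) (hf : ∀ x m, x m = 1 → f x = 0) (x : Fin i → G) :
    onTuples f ∘ₗ TensorProduct.mk F _ _ (bar F x) = f x := by
  by_cases h : ∃ m, x m = 1
  · obtain ⟨m, hm⟩ := h
    rw [hf x m hm, bar_eq_zero x m hm, map_zero, LinearMap.comp_zero]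
  · push Not at h
    refine LinearMap.ext fun y => ?_
    have hb : bar F x = barBasis F G i
        (fun m => (⟨x m, h m⟩ : {x : G // x ≠ 1})) := by
      rw [barBasis_apply]
    rw [LinearMap.comp_apply, TensorProduct.mk_apply, onTuples, TensorProduct.lift.tmul, hb,
      Module.Basis.constr_basis]

variable (F G V) in
/-- The `A`-bimodule `Y_{i,j} = B_i ⊗ K_j ≅ A ⊗ (FG / (F · 1))^{⊗ i} ⊗ Λʲ V ⊗ A`. -/
abbrev Y (i j : ℕ) : Type (max u v w) := FreeBimod F G V (Bar F G i ⊗[F] ⋀[F]^j V)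

variable (F V) in
/-- `y ↦ 1 ⊗ x₁ ⊗ ⋯ ⊗ xᵢ ⊗ y ⊗ 1` in `Y_{i,j}`. -/
def Y.gen {i : ℕ} (j : ℕ) (x : Fin i → G) : ⋀[F]^j V →ₗ[F] Y F G V i j :=
  TensorProduct.mk F (Ae F G V) (Bar F G i ⊗[F] ⋀[F]^j V) 1 ∘ₗ
    TensorProduct.mk F (Bar F G i) (⋀[F]^j V) (bar F x)

variable (F V) in
/-- The element `t₀ ⊗ t₁ ⊗ ⋯ ⊗ tᵢ ⊗ ᵃy ⊗ a` of `Y_{i,j}`, where `a = tᵢ₊₁`.  It corresponds to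
`(t₀ ⊗ t₁ ⊗ ⋯ ⊗ tᵢ₊₁) ⊗ (1 ⊗ y ⊗ 1)` in `B_i ⊗ K_j`. -/
def Y.elt {i : ℕ} (j : ℕ) (t : Fin (i + 2) → G) : ⋀[F]^j V →ₗ[F] Y F G V i j :=
  twist (t 0) (t (Fin.last (i + 1))) (Y.gen F V j fun m => t m.succ.castSucc)

variable (F V) in
/-- The bar differential `∑ₖ (-1)ᵏ t₀ ⊗ ⋯ ⊗ tₖ tₖ₊₁ ⊗ ⋯ ⊗ tᵢ₊₂`, tensored with `y`. -/
def Y.alt {i : ℕ} (j : ℕ) (t : Fin (i + 3) → G) : ⋀[F]^j V →ₗ[F] Y F G V i j :=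
  ∑ k : Fin (i + 2), (-1 : ℤ) ^ (k : ℕ) • Y.elt F V j (Fin.contractNth k.castSucc (· * ·) t)

variable (F G V) in
/-- The differential `d_B ⊗ id : Y_{i+1,j} → Y_{i,j}`. -/
def Y.dB (i j : ℕ) : Y F G V (i + 1) j →ₗ[Ae F G V] Y F G V i j :=
  extend (onTuples fun x : Fin (i + 1) → G => Y.alt F V j (Fin.cons 1 (Fin.snoc x 1)))

variable (F G V) in
/-- The differential `id ⊗ d_K : Y_{i,j+1} → Y_{i,j}`.  The element `1 ⊗ x₁ ⊗ ⋯ ⊗ xᵢ ⊗ 1` of `B_i`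
has `G`-degree `h = x₁ ⋯ xᵢ`, so that the factor `v ⊗ 1 - 1 ⊗ v` of the Koszul differential
becomes `ʰv ⊗ 1 - 1 ⊗ v`. -/
def Y.dK (i j : ℕ) : Y F G V i (j + 1) →ₗ[Ae F G V] Y F G V i j :=
  extend (onTuples fun x : Fin i → G => koszul (koszulCoeff F V (∏ m, x m)) (Y.gen F V j x))

theorem Y.ext {N : Type*} [AddCommGroup N] [Module F N] [Module (Ae F G V) N]
    [IsScalarTower F (Ae F G V) N] (i j : ℕ) {D D' : Y F G V i j →ₗ[Ae F G V] N}
    (h : ∀ x : Fin i → G, D.restrictScalars F ∘ₗ Y.gen F V j x =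
      D'.restrictScalars F ∘ₗ Y.gen F V j x) : D = D' := by
  refine TensorProduct.AlgebraTensorModule.ext fun a z => ?_
  have h1 : D.restrictScalars F ∘ₗ TensorProduct.mk F (Ae F G V) (Bar F G i ⊗[F] ⋀[F]^j V) 1 =
      D'.restrictScalars F ∘ₗ TensorProduct.mk F (Ae F G V) (Bar F G i ⊗[F] ⋀[F]^j V) 1 := by
    refine TensorProduct.ext ((barBasis F G i).ext fun p => ?_)
    rw [barBasis_apply]
    exact h _
  have := congrArg (fun z => a • z) (LinearMap.congr_fun h1 z)
  simpa [← map_smul, TensorProduct.smul_tmul'] using this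

theorem Y.alt_eq_zero {i : ℕ} (j : ℕ) (t : Fin (i + 3) → G) (m : Fin (i + 1))
    (hm : t m.succ.castSucc = 1) : Y.alt F V j t = 0 := by
  have hz : ∀ (s : Fin (i + 2) → G) (p : Fin i), s p.succ.castSucc = 1 →
      Y.elt F V j s = 0 := by
    intro s p hp
    have : Y.gen F V j (fun q : Fin i => s q.succ.castSucc) = 0 := by
      unfold Y.gen
      rw [bar_eq_zero (F := F) _ p hp]
      ext; simp
    unfold Y.elt
    rw [this]
    ext; simp [twist_apply]
  have hne : (m.castSucc : Fin (i + 2)) ≠ m.succ := by simp [Fin.ext_iff]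
  have hm' : ∀ q : Fin (i + 3), (q : ℕ) = m + 1 → t q = 1 := by
    intro q hq
    rw [← hm]; congr 1; ext; simpa using hq
  unfold Y.alt
  rw [Fintype.sum_eq_add _ _ hne]
  · have : Fin.contractNth (m.castSucc : Fin (i + 2)).castSucc (· * ·) t =
        Fin.contractNth (m.succ : Fin (i + 2)).castSucc (· * ·) t := by
      funext p
      simp only [Fin.contractNth, Fin.val_castSucc, Fin.val_succ]
      rcases lt_trichotomy (p : ℕ) m with h | h | h
      · rw [if_pos h, if_pos (by omega)]
      · rw [if_neg (by omega), if_pos h, if_pos (by omega), hm' p.succ (by simp [h]), mul_one]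
      · rw [if_neg (by omega), if_neg (by omega), if_neg (by omega)]
        by_cases h' : (p : ℕ) = m + 1
        · rw [if_pos h', hm' p.castSucc (by simp [h']), one_mul]
        · rw [if_neg h']
    rw [this]
    simp [pow_succ]
  · rintro k ⟨h1, h2⟩
    have h1 : (k : ℕ) ≠ m := fun h => h1 (Fin.ext (by simpa using h))
    have h2 : (k : ℕ) ≠ m + 1 := fun h => h2 (Fin.ext (by simpa using h))
    rcases lt_or_gt_of_ne h1 with h | h
    · rw [hz _ ⟨m - 1, by omega⟩, smul_zero]
      simp only [Fin.contractNth, Fin.val_castSucc, Fin.val_succ]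
      rw [if_neg (by omega), if_neg (by omega)]
      exact hm' _ (by simp; omega)
    · rw [hz _ ⟨m, by omega⟩, smul_zero]
      simp only [Fin.contractNth, Fin.val_castSucc, Fin.val_succ]
      rw [if_pos (by omega)]
      exact hm' _ (by simp)

theorem cons_snoc_apply {i : ℕ} (x : Fin i → G) (p : Fin (i + 2)) :
    (Fin.cons 1 (Fin.snoc x 1 : Fin (i + 1) → G) : Fin (i + 2) → G) p =
      if h : 0 < (p : ℕ) ∧ (p : ℕ) < i + 1 then x ⟨p - 1, by omega⟩ else 1 := by
  refine Fin.cases ?_ (fun q => ?_) p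
  · simp
  · refine Fin.lastCases ?_ (fun r => ?_) q
    · simp
    · simp

theorem Y.dB_gen {i : ℕ} (j : ℕ) (x : Fin (i + 1) → G) :
    (Y.dB F G V i j).restrictScalars F ∘ₗ Y.gen F V j x =
      Y.alt F V j (Fin.cons 1 (Fin.snoc x 1)) := by
  unfold Y.gen Y.dB
  rw [← LinearMap.comp_assoc, extend_comp_mk, onTuples_bar]
  intro x m hm
  apply Y.alt_eq_zero j _ m
  rw [cons_snoc_apply, dif_pos (by simp; omega)]
  simpa using hm

theorem Y.dK_gen {i : ℕ} (j : ℕ) (x : Fin i → G) :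
    (Y.dK F G V i j).restrictScalars F ∘ₗ Y.gen F V (j + 1) x =
      koszul (koszulCoeff F V (∏ m, x m)) (Y.gen F V j x) := by
  conv_lhs => unfold Y.gen Y.dK
  rw [← LinearMap.comp_assoc, extend_comp_mk, onTuples_bar]
  intro x m hm
  have : Y.gen F V j x = 0 := by
    unfold Y.gen
    rw [bar_eq_zero (F := F) _ m hm]
    ext; simp
  rw [this, koszul_zero]

theorem Y.dB_elt {i : ℕ} (j : ℕ) (t : Fin (i + 3) → G) :
    (Y.dB F G V i j).restrictScalars F ∘ₗ Y.elt F V j t = Y.alt F V j t := by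
  unfold Y.elt
  rw [map_twist, Y.dB_gen]
  unfold Y.alt
  rw [twist_sum]
  refine Finset.sum_congr rfl fun k _ => ?_
  rw [twist_zsmul]
  congr 1
  unfold Y.elt
  rw [twist_twist]
  congr 1
  · simp only [Fin.contractNth, cons_snoc_apply, Fin.val_castSucc, Fin.val_succ]
    by_cases hk : (k : ℕ) = 0
    · simp [hk]
    · simp [Nat.pos_of_ne_zero hk]
  · simp only [Fin.contractNth, cons_snoc_apply, Fin.val_castSucc, Fin.val_succ]
    by_cases hk : (k : ℕ) = i + 1
    · simp [hk]
      rfl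
    · have : (k : ℕ) < i + 1 := by omega
      simp [show ¬ (i + 1 < (k : ℕ)) by omega, show ¬ (i + 1 = (k : ℕ)) by omega]
  · congr 1
    funext p
    simp only [Fin.contractNth, cons_snoc_apply, Fin.val_castSucc, Fin.val_succ]
    split_ifs <;> first | omega | rfl

theorem contractNth_contractNth {n : ℕ} (t : Fin (n + 3) → G) (k l : Fin (n + 1)) (h : k ≤ l) :
    Fin.contractNth l.castSucc (· * ·) (Fin.contractNth k.castSucc.castSucc (· * ·) t) =
      Fin.contractNth k.castSucc (· * ·) (Fin.contractNth l.succ.castSucc (· * ·) t) := by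
  have h : (k : ℕ) ≤ l := h
  funext p
  simp only [Fin.contractNth, Fin.val_castSucc, Fin.val_succ]
  split_ifs <;> first | omega | rfl | simp [mul_assoc]

theorem Y.dB_comp_dB (i j : ℕ) : Y.dB F G V i j ∘ₗ Y.dB F G V (i + 1) j = 0 := by
  apply Y.ext
  intro x
  change (Y.dB F G V i j).restrictScalars F ∘ₗ
    ((Y.dB F G V (i + 1) j).restrictScalars F ∘ₗ Y.gen F V j x) = 0
  rw [Y.dB_gen]
  generalize (Fin.cons 1 (Fin.snoc x 1 : Fin (i + 3) → G) : Fin (i + 4) → G) = t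
  unfold Y.alt
  rw [comp_sum']
  simp only [LinearMap.comp_smul, Y.dB_elt]
  unfold Y.alt
  simp only [Finset.smul_sum]
  rw [Fin.sum_sum_eq_sum_triangle_add]
  refine Finset.sum_eq_zero fun k _ => Finset.sum_eq_zero fun l hl => ?_
  rw [contractNth_contractNth t k l (Finset.mem_Ici.1 hl)]
  refine LinearMap.ext fun y => ?_
  simp [smul_smul, pow_succ, mul_comm ((-1 : ℤ) ^ (l : ℕ))]

theorem Y.dK_comp_dK (i j : ℕ) : Y.dK F G V i j ∘ₗ Y.dK F G V i (j + 1) = 0 := by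
  apply Y.ext
  intro x
  change (Y.dK F G V i j).restrictScalars F ∘ₗ
    ((Y.dK F G V i (j + 1)).restrictScalars F ∘ₗ Y.gen F V (j + 2) x) = 0
  rw [Y.dK_gen, map_koszul, Y.dK_gen, koszul_koszul]

theorem Y.dK_elt {i : ℕ} (j : ℕ) (t : Fin (i + 2) → G) :
    (Y.dK F G V i j).restrictScalars F ∘ₗ Y.elt F V (j + 1) t =
      koszul (koszulCoeff F V (∏ m, t m)) (Y.elt F V j t) := by
  unfold Y.elt
  rw [map_twist, Y.dK_gen, ← koszul_twist, Fin.prod_univ_succ, Fin.prod_univ_castSucc, mul_assoc]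
  rfl

theorem prod_contractNth : ∀ {n : ℕ} (t : Fin (n + 2) → G) (k : Fin (n + 1)),
    ∏ m, Fin.contractNth k.castSucc (· * ·) t m = ∏ m, t m := by
  intro n t k
  have h : ∀ p, Fin.contractNth k.castSucc (· * ·) t p =
      (if p = k then t k.succ else 1) * t (k.succ.succAbove p) := by
    intro p
    rcases lt_trichotomy p k with h | h | h
    · rw [Fin.contractNth_apply_of_lt _ _ _ _ (by simpa using h), if_neg h.ne, one_mul,
        Fin.succAbove_of_castSucc_lt _ _ (show (p : ℕ) < k + 1 by have : (p : ℕ) < k := h; omega)]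
    · subst h
      rw [Fin.contractNth_apply_of_eq _ _ _ _ (by simp), if_pos rfl, Fin.succAbove_succ_self,
        mul_comm]
    · rw [Fin.contractNth_apply_of_gt _ _ _ _ (by simpa using h), if_neg h.ne', one_mul,
        Fin.succAbove_of_le_castSucc _ _ (show (k : ℕ) + 1 ≤ p from h)]
  simp only [h, Finset.prod_mul_distrib, Finset.prod_ite_eq', Finset.mem_univ, if_true]
  rw [Fin.prod_univ_succAbove t k.succ]

theorem Y.dB_comp_dK (i j : ℕ) :
    Y.dB F G V i j ∘ₗ Y.dK F G V (i + 1) j = Y.dK F G V i j ∘ₗ Y.dB F G V i (j + 1) := by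
  apply Y.ext
  intro x
  change (Y.dB F G V i j).restrictScalars F ∘ₗ
      ((Y.dK F G V (i + 1) j).restrictScalars F ∘ₗ Y.gen F V (j + 1) x) =
    (Y.dK F G V i j).restrictScalars F ∘ₗ
      ((Y.dB F G V i (j + 1)).restrictScalars F ∘ₗ Y.gen F V (j + 1) x)
  rw [Y.dK_gen, map_koszul, Y.dB_gen, Y.dB_gen]
  have hx : ∏ m, x m = ∏ m, (Fin.cons 1 (Fin.snoc x 1 : Fin (i + 2) → G) : Fin (i + 3) → G) m := by
    rw [Fin.prod_cons, Fin.prod_snoc, one_mul, mul_one]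
  rw [hx]
  generalize (Fin.cons 1 (Fin.snoc x 1 : Fin (i + 2) → G) : Fin (i + 3) → G) = t
  unfold Y.alt
  rw [comp_sum', koszul_sum]
  refine Finset.sum_congr rfl fun k _ => ?_
  rw [LinearMap.comp_smul, koszul_zsmul, Y.dK_elt, prod_contractNth]

end Bar

section Complexes

variable (F V) in
/-- The periodic-twisted-Koszul complex `X = P ⊗ᴳ K` of `A`-bimodules, for `g` in `G`. -/
def XComplex [Finite G] (g : G) : ChainComplex (ModuleCat.{max u v w} (Ae F G V)) ℕ :=
  ChainComplex.of (fun n => ModuleCat.of (Ae F G V) (Tot (X F G V) n))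
    (fun n => ModuleCat.ofHom (Tot.d (X.dP F V g) (X.dK F V g) n))
    (fun n => by
      rw [← ModuleCat.ofHom_comp, Tot.d_comp_d _ _ (X.dP_comp_dP g) (X.dK_comp_dK g)
        (X.dP_comp_dK g)]
      rfl)

variable (F G V) in
/-- The reduced-bar-twisted-Koszul complex `Y = B ⊗ᴳ K` of `A`-bimodules. -/
def YComplex : ChainComplex (ModuleCat.{max u v w} (Ae F G V)) ℕ :=
  ChainComplex.of (fun n => ModuleCat.of (Ae F G V) (Tot (Y F G V) n))
    (fun n => ModuleCat.ofHom (Tot.d (Y.dB F G V) (Y.dK F G V) n))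
    (fun n => by
      rw [← ModuleCat.ofHom_comp, Tot.d_comp_d _ _ Y.dB_comp_dB Y.dK_comp_dK Y.dB_comp_dK]
      rfl)

/-- The element `a ⊗ y ⊗ b` of the summand `X_{i,j} = A ⊗ Λʲ V ⊗ A` of `X_n`, `n = i + j`. -/
def XComplex.tensor [Finite G] (g : G) {i j n : ℕ} (h : i + j = n)
    (a : A F G V) (y : ⋀[F]^j V) (b : A F G V) : (XComplex F V g).X n :=
  Tot.incl (R := Ae F G V) (M := X F G V) h (lr F G V a b ⊗ₜ[F] y)

/-- The element `a ⊗ x₁ ⊗ ⋯ ⊗ xᵢ ⊗ y ⊗ b` of the summand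
`Y_{i,j} = A ⊗ (FG / (F · 1))^{⊗ i} ⊗ Λʲ V ⊗ A` of `Y_n`, `n = i + j`. -/
def YComplex.tensor {i j n : ℕ} (h : i + j = n)
    (a : A F G V) (x : Fin i → G) (y : ⋀[F]^j V) (b : A F G V) : (YComplex F G V).X n :=
  Tot.incl (R := Ae F G V) (M := Y F G V) h (lr F G V a b ⊗ₜ[F] (bar F x ⊗ₜ[F] y))

variable (F V) in
/-- The subspace `Sᵖ(V)` of `S(V)`. -/
def symPow (p : ℕ) : Submodule F (SymmetricAlgebra F V) :=
  LinearMap.range (SymmetricAlgebra.ι F V) ^ p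

variable (F V) in
/-- The part of `X_n` of polynomial degree `d` and `G`-degree `h`.  The element
`r a' ⊗ y ⊗ s a` of `X_{i,j}`, with `r ∈ Sᵖ(V)`, `s ∈ S^q(V)` and `a', a ∈ G`, has polynomial degree
`p + j + q`; its `G`-degree is `a' a` for even `i` and `a' a g` for odd `i`. -/
def XComplex.homog [Finite G] (g : G) (n d : ℕ) (h : G) :
    Submodule F (Tot (X F G V) n) :=
  Submodule.span F {z | ∃ (i j p q : ℕ) (hn : i + j = n) (r s : SymmetricAlgebra F V) (a' a : G)
    (y : ⋀[F]^j V), r ∈ symPow F V p ∧ s ∈ symPow F V q ∧ p + j + q = d ∧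
      a' * a * (if Even i then 1 else g) = h ∧
      z = XComplex.tensor g hn (mon r a') y (mon s a)}

variable (F V) in
/-- The part of `Y_n` of polynomial degree `d` and `G`-degree `h`.  The element
`r a' ⊗ x₁ ⊗ ⋯ ⊗ xᵢ ⊗ y ⊗ s a` of `Y_{i,j}`, with `r ∈ Sᵖ(V)`, `s ∈ S^q(V)` and
`a', x₁, …, xᵢ, a ∈ G`, has polynomial degree `p + j + q` and `G`-degree `a' x₁ ⋯ xᵢ a`. -/
def YComplex.homog (n d : ℕ) (h : G) : Submodule F (Tot (Y F G V) n) :=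
  Submodule.span F {z | ∃ (i j p q : ℕ) (hn : i + j = n) (r s : SymmetricAlgebra F V) (a' a : G)
    (x : Fin i → G) (y : ⋀[F]^j V), r ∈ symPow F V p ∧ s ∈ symPow F V q ∧ p + j + q = d ∧
      a' * (∏ m, x m) * a = h ∧
      z = YComplex.tensor hn (mon r a') x y (mon s a)}

/-- The tuple `(g^{i_k}, g, g^{i_{k-1}}, g, …, g^{i_1}, g)`, where `i_m` is `e (m - 1)`. -/
def evenWord (g : G) {k : ℕ} (e : Fin k → ℕ) : Fin (2 * k) → G := fun m =>
  if (m : ℕ) % 2 = 0 then g ^ e (Fin.rev ⟨m / 2, by omega⟩) else g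

/-- The tuple `(g, g^{i_k}, g, g^{i_{k-1}}, g, …, g^{i_1}, g)`, where `i_m` is `e (m - 1)`. -/
def oddWord (g : G) {k : ℕ} (e : Fin k → ℕ) : Fin (2 * k + 1) → G :=
  Fin.cons g (evenWord g e)

end Complexes

end TwistedKoszul

end

open CategoryTheory TwistedKoszul

/-!
Both complexes are twisted products of a resolution of `ℤ` by `G`-bimodules with the Koszul complex
of `V`: a word `t₀ ⊗ t₁ ⊗ ⋯ ⊗ tᵢ₊₁` of group elements and `y ∈ Λʲ V` give the element
`t₀ ⊗ t₁ ⊗ ⋯ ⊗ tᵢ ⊗ ᵃy ⊗ a` with `a = tᵢ₊₁`, and the differentials `d_P` and `d_B` act on the word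
only.  A map of integral `G`-bimodules that preserves the `G`-degree therefore induces maps of the
summands `X_{i,j}` and `Y_{i,j}` that commute with `d_K` (`X.eval`, `Y.eval`, `X.dK_eval`,
`Y.dK_eval`), and everything reduces to comparing the periodic resolution `P` of the cyclic group
`G`, with terms `ℤ[G × G]`, to its bar resolution `B`, with terms `ℤ[G^(i+2)]`.

Each of the two resolutions has a contracting homotopy that is linear for the right action.  On `B`
it is `s(t) = 1 ⊗ t`.  On `P` it is `h(gⁿ ⊗ 1) = ∑_{l < n} g^(n-1-l) ⊗ gˡ` from even to odd degrees
and `h(gⁿ ⊗ 1) = 1 ⊗ 1` or `0` from odd to even degrees, according as `n = |G| - 1` or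
`n < |G| - 1`, where `0 ≤ n < |G|`.  The comparison maps are built from them by recursion:
`ι(1 ⊗ 1) = s(ι(d(1 ⊗ 1)))` and `π(t₀ ⊗ t') = t₀ h(π(t'))`.  That they are chain maps
(`Words.d_iotaGen`, `Words.proj_d`) follows by induction from the homotopy identities `Words.d_cons`
and `Pairs.coeff_mul_homotopy_add`.

The homotopy of `P` also satisfies `h² = 0` and `h(1 ⊗ b) = 0`.  These side conditions give
`π ι = id` (`Words.proj_iotaGen`), because `π ι (1 ⊗ 1) = h(d(1 ⊗ 1)) = 1 ⊗ 1 - d(h(1 ⊗ 1))`, and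
they make `π` vanish on words with an inner letter `1` (`Words.proj_eq_zero`), so that it descends
to the reduced bar resolution.  Unwinding the recursions two steps at a time gives the closed
formulas (`Words.iotaGen_even`, `Words.proj_even` and their odd counterparts): the sum over `i_k`
in `ι` is the norm element `∑ₗ g^(|G|-1-l) ⊗ gˡ`, and the condition `i_{2m-1} + i_{2m} ≥ |G|` in `π`
expresses that `g^(|G|-1)` occurs among the left factors to which `h` is applied.
-/

set_option linter.unusedSectionVars false

noncomputable section

namespace TwistedKoszul

open FreeAbelianGroup

/-! ### The periodic resolution of a cyclic group and its contracting homotopy -/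

section Pairs

variable {G : Type*} [CommGroup G]

variable (G) in
/-- The `G`-bimodule `ℤ[G × G]`, the integral form of each term of the periodic resolution of `G`.
As `G` is commutative it is a commutative ring, and the pair `(a, b)` acts by multiplication. -/
abbrev Pairs := FreeAbelianGroup (G × G)

namespace Pairs

/-- The sum `∑ₗ (g^(n-1-l), gˡ)` over `l < n`. -/
def geomSum (g : G) (n : ℕ) : Pairs G :=
  ∑ l ∈ Finset.range n, of (g ^ (n - 1 - l), g ^ l)

theorem of_pow (x : G × G) (n : ℕ) : of (x ^ n) = (of x : Pairs G) ^ n :=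
  map_pow (FreeAbelianGroup.ofMulHom (α := G × G)) x n

theorem of_one_one : (of (1, 1) : Pairs G) = 1 := rfl

theorem geomSum_eq (g : G) (n : ℕ) :
    geomSum g n = ∑ l ∈ Finset.range n, (of (1, g) : Pairs G) ^ l * of (g, 1) ^ (n - 1 - l) := by
  refine Finset.sum_congr rfl fun l _ => ?_
  rw [← of_pow, ← of_pow, of_mul_of]
  simp

theorem geomSum_zero (g : G) : geomSum g 0 = 0 := by simp [geomSum]

theorem sub_mul_geomSum (g : G) (n : ℕ) :
    (of (g, 1) - of (1, g)) * geomSum g n = (of (g ^ n, 1) - of (1, g ^ n) : Pairs G) := by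
  have h := (Commute.all (of (1, g) : Pairs G) (of (g, 1))).mul_geom_sum₂ n
  rw [geomSum_eq, ← neg_inj, ← neg_mul, neg_sub, h, ← of_pow, ← of_pow]
  simp

theorem geomSum_succ (g : G) (n : ℕ) :
    geomSum g (n + 1) = of (g ^ n, 1) + of (1, g) * geomSum g n := by
  rw [geomSum, Finset.sum_range_succ', geomSum, Finset.mul_sum, add_comm]
  congr 1
  · simp
  · refine Finset.sum_congr rfl fun l hl => ?_
    rw [of_mul_of, Prod.mk_mul_mk, one_mul, ← pow_succ',
      show n + 1 - 1 - (l + 1) = n - 1 - l by omega]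

variable [Finite G]

/-- The element of `ℤ[G × G]` by which the differential `P_{i+1} → P_i` of the periodic resolution
multiplies. -/
def coeff (g : G) (i : ℕ) : Pairs G :=
  if Even i then of (g, 1) - of (1, g) else geomSum g (Nat.card G)

theorem coeff_mul_coeff_succ (g : G) (i : ℕ) : coeff g i * coeff g (i + 1) = 0 := by
  have h : (of (g, 1) - of (1, g)) * geomSum g (Nat.card G) = (0 : Pairs G) := by
    rw [sub_mul_geomSum, pow_card_eq_one', sub_self]
  by_cases hi : Even i
  · rw [coeff, coeff, if_pos hi, if_neg (by simpa [Nat.even_add_one] using hi), h]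
  · rw [coeff, coeff, if_neg hi, if_pos (by simpa [Nat.even_add_one] using hi), mul_comm, h]

/-- The least exponent `n` with `gⁿ = x` (`0` if there is none). -/
def log (g x : G) : ℕ := sInf {n | g ^ n = x}

theorem log_pow {g : G} (hg : orderOf g = Nat.card G) {n : ℕ} (hn : n < Nat.card G) :
    log g (g ^ n) = n := by
  refine le_antisymm (Nat.sInf_le rfl) (le_csInf ⟨n, rfl⟩ fun m hm => ?_)
  by_contra! hlt
  exact hlt.ne (pow_injOn_Iio_orderOf (by simp; omega) (by simp; omega) hm)

theorem exists_pow_eq {g : G} (hg : orderOf g = Nat.card G) (x : G) :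
    ∃ n < Nat.card G, g ^ n = x := by
  have hx : x ∈ Submonoid.powers g := by
    rw [mem_powers_iff_mem_zpowers,
      (Subgroup.card_eq_iff_eq_top _).1 ((Nat.card_zpowers g).trans hg)]
    trivial
  obtain ⟨n, rfl⟩ := hx
  exact ⟨n % orderOf g, hg ▸ Nat.mod_lt _ (hg ▸ Nat.card_pos), pow_mod_orderOf g n⟩

open Classical in
/-- The contracting homotopy `P_i → P_{i+1}` of the periodic resolution.  It commutes with the
right action of `G` only. -/
def homotopy (g : G) (i : ℕ) : Pairs G →+ Pairs G :=
  lift fun p => if Even i then of (1, p.2) * geomSum g (log g p.1)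
    else if p.1 * g = 1 then of (1, p.2) else 0

theorem homotopy_right (g : G) (i : ℕ) (b : G) (p : Pairs G) :
    homotopy g i (of (1, b) * p) = of (1, b) * homotopy g i p := by
  induction p using FreeAbelianGroup.induction_on with
  | zero => simp
  | of x =>
    rw [of_mul_of, homotopy, lift_apply_of, lift_apply_of]
    simp only [Prod.fst_mul, Prod.snd_mul, one_mul]
    split_ifs <;> simp_all [of_mul_of, ← mul_assoc]
  | neg x h => rw [mul_neg, map_neg, map_neg, h, mul_neg]
  | add x y hx hy => rw [mul_add, map_add, map_add, hx, hy, mul_add]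

theorem homotopy_even {g : G} (hg : orderOf g = Nat.card G) {i : ℕ} (hi : Even i) {n : ℕ}
    (hn : n < Nat.card G) (b : G) : homotopy g i (of (g ^ n, b)) = of (1, b) * geomSum g n := by
  rw [homotopy, lift_apply_of, if_pos hi, log_pow hg hn]

open Classical in
theorem homotopy_odd (g : G) {i : ℕ} (hi : ¬ Even i) (a b : G) :
    homotopy g i (of (a, b)) = if a * g = 1 then of (1, b) else 0 := by
  rw [homotopy, lift_apply_of, if_neg hi]

open Classical in
/-- At most one summand of the geometric sum has left factor `g^(|G|-1)` after multiplication by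
`g^m`; it is the one that the homotopy retains. -/
theorem homotopy_odd_mul_geomSum {g : G} (hg : orderOf g = Nat.card G) {i : ℕ} (hi : ¬ Even i)
    {m n : ℕ} (hm : m < Nat.card G) (hn : n ≤ Nat.card G) (b : G) :
    homotopy g i (of (g ^ m, b) * geomSum g n) =
      if Nat.card G ≤ m + n then of (1, g ^ (m + n - Nat.card G) * b) else 0 := by
  have key : ∀ l ∈ Finset.range n, homotopy g i (of (g ^ m, b) * of (g ^ (n - 1 - l), g ^ l)) =
      if Nat.card G + l = m + n then of (1, g ^ l * b) else 0 := by
    intro l hl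
    have hl := Finset.mem_range.1 hl
    rw [of_mul_of, Prod.mk_mul_mk, homotopy_odd g hi, mul_comm b]
    refine if_congr ?_ rfl rfl
    rw [← pow_add, ← pow_succ, ← orderOf_dvd_iff_pow_eq_one, hg]
    constructor
    · intro h
      -- the exponent lies strictly between `0` and `2 |G|`
      obtain ⟨c, hc⟩ := h
      have hc1 : c = 1 := by
        rcases c with _ | _ | c
        · omega
        · rfl
        · have : Nat.card G * (c + 1 + 1) = Nat.card G * c + Nat.card G + Nat.card G := by ring
          omega
      subst hc1
      omega
    · intro h
      exact ⟨1, by omega⟩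
  rw [geomSum, Finset.mul_sum, map_sum, Finset.sum_congr rfl key]
  split_ifs with h
  · rw [Finset.sum_eq_single_of_mem (m + n - Nat.card G)]
    · rw [if_pos (by omega)]
    · rw [Finset.mem_range]
      omega
    · intro l _ hl
      rw [if_neg (by omega)]
  · exact Finset.sum_eq_zero fun l _ => if_neg (by omega)

/-- `homotopy` contracts the periodic resolution in positive degrees. -/
theorem coeff_mul_homotopy_add {g : G} (hg : orderOf g = Nat.card G) (i : ℕ) (p : Pairs G) :
    coeff g (i + 1) * homotopy g (i + 1) p + homotopy g i (coeff g i * p) = p := by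
  induction p using FreeAbelianGroup.induction_on with
  | zero => simp
  | neg x h =>
    rw [map_neg, mul_neg, mul_neg, map_neg, ← neg_add, h]
  | add x y hx hy =>
    rw [map_add, mul_add, mul_add, map_add, add_add_add_comm, hx, hy]
  | of x =>
    obtain ⟨x, b⟩ := x
    obtain ⟨n, hn, rfl⟩ := exists_pow_eq hg x
    have hx : (of (g ^ n, b) : Pairs G) = of (1, b) * of (g ^ n, 1) := by simp [of_mul_of]
    rw [hx, mul_left_comm, homotopy_right, homotopy_right, mul_left_comm, ← mul_add]
    congr 1
    have hpos : 0 < Nat.card G := Nat.card_pos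
    by_cases hi : Even i
    · have hi' : ¬ Even (i + 1) := by simpa [Nat.even_add_one] using hi
      rw [coeff, if_neg hi', homotopy_odd g hi', coeff, if_pos hi, sub_mul, map_sub,
        homotopy_right, homotopy_even hg hi hn, of_mul_of, Prod.mk_mul_mk, one_mul, ← pow_succ',
        ← pow_succ, of_one_one, one_mul]
      by_cases h : n + 1 = Nat.card G
      · have h1 : homotopy g i (of (1, 1)) = 0 := by
          simpa [geomSum_zero] using homotopy_even hg hi hpos 1
        rw [if_pos (by rw [h, pow_card_eq_one']), mul_one, h, pow_card_eq_one',
          h1, zero_sub, ← h, geomSum_succ, add_neg_cancel_right]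
      · have h1 : g ^ (n + 1) ≠ 1 := pow_ne_one_of_lt_orderOf (by omega) (by omega)
        rw [if_neg h1, mul_zero, zero_add, homotopy_even hg hi (by omega), geomSum_succ,
          of_one_one, one_mul, add_sub_cancel_right]
    · have hi' : Even (i + 1) := by simpa [Nat.even_add_one] using hi
      rw [coeff, if_pos hi', homotopy_even hg hi' hn, coeff, if_neg hi, mul_comm (geomSum _ _),
        homotopy_odd_mul_geomSum hg hi hn le_rfl, if_pos (by omega), Nat.add_sub_cancel,
        of_one_one, one_mul, sub_mul_geomSum, mul_one,
        sub_add_cancel]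

theorem coeff_zero_mul_homotopy {g : G} (hg : orderOf g = Nat.card G) (a b : G) :
    coeff g 0 * homotopy g 0 (of (a, b)) = of (a, b) - of (1, a * b) := by
  obtain ⟨n, hn, rfl⟩ := exists_pow_eq hg a
  rw [homotopy_even hg Even.zero hn, coeff, if_pos Even.zero, mul_left_comm, sub_mul_geomSum,
    mul_sub, of_mul_of, of_mul_of]
  simp [mul_comm b]

theorem homotopy_one [Nontrivial G] {g : G} (hg : orderOf g = Nat.card G) (i : ℕ) (b : G) :
    homotopy g i (of (1, b)) = 0 := by
  have h2 : 1 < Nat.card G := Finite.one_lt_card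
  by_cases hi : Even i
  · rw [← pow_zero g, homotopy_even hg hi (by omega), geomSum_zero, mul_zero]
  · rw [homotopy_odd g hi, one_mul, if_neg]
    rintro rfl
    rw [orderOf_one] at hg
    omega

theorem homotopy_homotopy [Nontrivial G] {g : G} (hg : orderOf g = Nat.card G) (i : ℕ)
    (p : Pairs G) : homotopy g (i + 1) (homotopy g i p) = 0 := by
  induction p using FreeAbelianGroup.induction_on with
  | zero => simp
  | neg x h => rw [map_neg, map_neg, h, neg_zero]
  | add x y hx hy => rw [map_add, map_add, hx, hy, add_zero]
  | of x =>
    obtain ⟨x, b⟩ := x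
    by_cases hi : Even i
    · obtain ⟨n, hn, rfl⟩ := exists_pow_eq hg x
      have := homotopy_odd_mul_geomSum hg (by simpa [Nat.even_add_one] using hi : ¬ Even (i + 1))
        Nat.card_pos hn.le b
      rw [pow_zero] at this
      rw [homotopy_even hg hi hn, this, if_neg (by omega)]
    · rw [homotopy_odd g hi]
      split_ifs
      · exact homotopy_one hg _ _
      · exact map_zero _

end Pairs

end Pairs

/-! ### The bar resolution and the comparison maps -/

section Words

variable {G : Type*} [CommGroup G]

variable (G) in
/-- The term `ℤ[G^(i+2)]` of the unreduced bar resolution of `G`, spanned by the words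
`t₀ ⊗ ⋯ ⊗ tᵢ₊₁`.  The words are multiplied entrywise. -/
abbrev Words (i : ℕ) := FreeAbelianGroup (Fin (i + 2) → G)

namespace Words

/-- The word `(a, 1, …, 1, b)`; multiplication by it is the action of `(a, b)`. -/
def ends (i : ℕ) : G × G →* (Fin (i + 2) → G) where
  toFun p m := (if (m : ℕ) = 0 then p.1 else 1) * (if (m : ℕ) = i + 1 then p.2 else 1)
  map_one' := by ext; simp
  map_mul' p q := by
    ext m
    simp only [Prod.fst_mul, Prod.snd_mul, Pi.mul_apply]
    split_ifs <;> simp [mul_mul_mul_comm]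

variable (G) in
/-- The ring homomorphism `ℤ[G × G] → ℤ[G^(i+2)]` through which `ℤ[G × G]` acts on words. -/
def scalar (i : ℕ) : Pairs G →+* Words G i :=
  liftMonoid (FreeAbelianGroup.ofMulHom.comp (ends i))

theorem scalar_of (i : ℕ) (p : G × G) : scalar G i (of p) = of (ends i p) :=
  lift_apply_of _ _

variable (G) in
/-- The bar differential `t ↦ ∑ₖ (-1)ᵏ t₀ ⊗ ⋯ ⊗ tₖ tₖ₊₁ ⊗ ⋯ ⊗ tᵢ₊₂`. -/
def d (i : ℕ) : Words G (i + 1) →+ Words G i :=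
  lift fun t => ∑ k : Fin (i + 2), (-1 : ℤ) ^ (k : ℕ) • of (Fin.contractNth k.castSucc (· * ·) t)

theorem d_of (i : ℕ) (t : Fin (i + 3) → G) : d G i (of t) =
    ∑ k : Fin (i + 2), (-1 : ℤ) ^ (k : ℕ) • of (Fin.contractNth k.castSucc (· * ·) t) :=
  lift_apply_of _ _

theorem contractNth_ends_mul {i : ℕ} (k : Fin (i + 2)) (p : G × G) (t : Fin (i + 3) → G) :
    Fin.contractNth k.castSucc (· * ·) (ends (i + 1) p * t) =
      ends i p * Fin.contractNth k.castSucc (· * ·) t := by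
  funext m
  simp only [Fin.contractNth, Fin.val_castSucc, Fin.val_succ, ends, MonoidHom.coe_mk, OneHom.coe_mk,
    Pi.mul_apply]
  have := m.2
  have := k.2
  split_ifs <;> first | contradiction | omega | simp [mul_assoc, mul_left_comm]

/-- An additive map that commutes with the action of `G × G` on words commutes with scalars. -/
theorem map_scalar_mul {M : Type*} [Ring M] {i : ℕ} (φ : Words G i →+ M) (ψ : Pairs G →+* M)
    (h : ∀ p t, φ (of (ends i p * t)) = ψ (of p) * φ (of t)) (p : Pairs G) (w : Words G i) :
    φ (scalar G i p * w) = ψ p * φ w := by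
  induction p using FreeAbelianGroup.induction_on with
  | zero => simp
  | neg x hx => rw [map_neg, neg_mul, map_neg, hx, map_neg, neg_mul]
  | add x y hx hy => rw [map_add, add_mul, map_add, hx, hy, map_add, add_mul]
  | of p =>
    induction w using FreeAbelianGroup.induction_on with
    | zero => simp
    | neg x hx => rw [mul_neg, map_neg, hx, map_neg, mul_neg]
    | add x y hx hy => rw [mul_add, map_add, hx, hy, map_add, mul_add]
    | of t => rw [scalar_of, of_mul_of, h]

theorem d_scalar_mul (i : ℕ) (p : Pairs G) (w : Words G (i + 1)) :
    d G i (scalar G (i + 1) p * w) = scalar G i p * d G i w := by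
  refine map_scalar_mul (d G i) (scalar G i) (fun p t => ?_) p w
  rw [d_of, d_of, Finset.mul_sum]
  refine Finset.sum_congr rfl fun k _ => ?_
  rw [contractNth_ends_mul, scalar_of, mul_smul_comm, of_mul_of]

variable {i : ℕ}

/-- The map `t₀ ⊗ ⋯ ⊗ tᵢ₊₁ ↦ a ⊗ t₀ ⊗ ⋯ ⊗ tᵢ₊₁`, which for `a = 1` contracts the bar resolution. -/
def cons (a : G) : Words G i →+ Words G (i + 1) := map fun t => (Fin.cons a t : Fin (i + 3) → G)

theorem cons_of (a : G) (t : Fin (i + 2) → G) :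
    cons a (of t) = of (Fin.cons a t : Fin (i + 3) → G) := map_of_apply _

theorem contractNth_zero_cons (a : G) (t : Fin (i + 2) → G) :
    Fin.contractNth (0 : Fin (i + 2)).castSucc (· * ·) (Fin.cons a t : Fin (i + 3) → G) =
      ends i (a, 1) * t := by
  funext m
  refine Fin.cases ?_ (fun m => ?_) m
  · simp [Fin.contractNth, ends]
  · simp [Fin.contractNth, ends]

theorem contractNth_succ_cons {α : Type*} (op : α → α → α) {n : ℕ} (k : Fin (n + 1)) (a : α)
    (t : Fin (n + 1) → α) :
    Fin.contractNth k.succ op (Fin.cons a t : Fin (n + 2) → α) =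
      Fin.cons a (Fin.contractNth k op t) := by
  funext m
  refine Fin.cases ?_ (fun m => ?_) m
  · simp [Fin.contractNth]
  · simp [Fin.contractNth]

theorem d_cons (a : G) (w : Words G (i + 1)) :
    d G (i + 1) (cons a w) = scalar G (i + 1) (of (a, 1)) * w - cons a (d G i w) := by
  induction w using FreeAbelianGroup.induction_on with
  | zero => simp
  | neg x hx => rw [map_neg, map_neg, map_neg, map_neg, hx]; ring
  | add x y hx hy => rw [map_add, map_add, map_add, map_add, hx, hy]; ring
  | of t =>
    rw [cons_of, d_of, Fin.sum_univ_succ, contractNth_zero_cons, d_of, map_sum, scalar_of,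
      of_mul_of, sub_eq_add_neg, ← Finset.sum_neg_distrib]
    congr 1
    refine Finset.sum_congr rfl fun k _ => ?_
    rw [← Fin.succ_castSucc, contractNth_succ_cons, map_zsmul, cons_of, Fin.val_succ, pow_succ]
    simp

theorem scalar_one_mul (w : Words G i) : scalar G i (of (1, 1)) * w = w := by
  rw [Pairs.of_one_one, map_one, one_mul]

theorem d_zero_cons (a : G) (t : Fin 2 → G) :
    d G 0 (cons a (of t)) = of (ends 0 (a, 1) * t) - of ![a, t 0 * t 1] := by
  rw [cons_of, d_of, Fin.sum_univ_two, contractNth_zero_cons, sub_eq_add_neg]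
  congr 1
  rw [show (1 : Fin 2).castSucc = (0 : Fin 2).succ from rfl, contractNth_succ_cons]
  have : Fin.cons a (Fin.contractNth 0 (· * ·) t) = ![a, t 0 * t 1] := by
    funext m
    fin_cases m <;> rfl
  simp [this]

section Inclusion

variable [Finite G]

/-- The image of `1 ⊗ 1` under the comparison map from the periodic to the bar resolution: in degree
`i + 1` it is the contracting homotopy of the bar resolution, applied to the image of `d(1 ⊗ 1)`. -/
def iotaGen (g : G) : ∀ i, Words G i
  | 0 => 1
  | i + 1 => cons 1 (scalar G i (Pairs.coeff g i) * iotaGen g i)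

theorem d_iotaGen (g : G) : ∀ i,
    d G i (iotaGen g (i + 1)) = scalar G i (Pairs.coeff g i) * iotaGen g i
  | 0 => by
    simp only [iotaGen, mul_one]
    rw [Pairs.coeff, if_pos Even.zero, map_sub, scalar_of, scalar_of, map_sub, map_sub,
      d_zero_cons, d_zero_cons]
    simp [ends, show ∀ f : Fin 2 → G, (fun _ => 1) * f = f from one_mul]
  | i + 1 => by
    rw [iotaGen, d_cons, scalar_one_mul, d_scalar_mul, d_iotaGen g i, ← mul_assoc, ← map_mul,
      mul_comm (Pairs.coeff g (i + 1)), Pairs.coeff_mul_coeff_succ, map_zero, zero_mul, map_zero,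
      sub_zero]

end Inclusion

section Projection

variable [Finite G]

/-- The comparison map from the bar to the periodic resolution: on `t₀ ⊗ t'` it is `t₀` times the
contracting homotopy of the periodic resolution, applied to the value at `t'`. -/
def proj (g : G) : ∀ i, Words G i →+ Pairs G
  | 0 => lift fun t => of (t 0, t 1)
  | i + 1 => lift fun t => of (t 0, 1) * Pairs.homotopy g i (proj g i (of (Fin.tail t)))

theorem proj_succ_of (g : G) (i : ℕ) (t : Fin (i + 3) → G) : proj g (i + 1) (of t) =
    of (t 0, 1) * Pairs.homotopy g i (proj g i (of (Fin.tail t))) := by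
  rw [proj, lift_apply_of]

theorem proj_cons (g : G) (a : G) (w : Words G i) :
    proj g (i + 1) (cons a w) = of (a, 1) * Pairs.homotopy g i (proj g i w) := by
  induction w using FreeAbelianGroup.induction_on with
  | zero => simp
  | neg x hx => rw [map_neg, map_neg, map_neg, map_neg, hx, mul_neg]
  | add x y hx hy => rw [map_add, map_add, map_add, map_add, hx, hy, mul_add]
  | of t => rw [cons_of, proj_succ_of]; simp

theorem tail_ends_mul (p : G × G) (t : Fin (i + 3) → G) :
    Fin.tail (ends (i + 1) p * t) = ends i (1, p.2) * Fin.tail t := by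
  funext m
  simp [Fin.tail, ends]

theorem proj_scalar_mul (g : G) : ∀ (i : ℕ) (p : Pairs G) (w : Words G i),
    proj g i (scalar G i p * w) = p * proj g i w
  | 0, p, w => by
    refine map_scalar_mul (proj g 0) (RingHom.id _) (fun ⟨a, b⟩ t => ?_) p w
    rw [proj, lift_apply_of, lift_apply_of]
    simp [ends, of_mul_of]
  | i + 1, p, w => by
    refine map_scalar_mul (proj g (i + 1)) (RingHom.id _) (fun ⟨a, b⟩ t => ?_) p w
    rw [proj_succ_of, proj_succ_of, tail_ends_mul, of_mul, ← scalar_of, proj_scalar_mul g i,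
      Pairs.homotopy_right, ← mul_assoc, ← mul_assoc, of_mul_of, RingHom.id_apply, of_mul_of]
    simp [ends, mul_comm]

theorem proj_d {g : G} (hg : orderOf g = Nat.card G) : ∀ (i : ℕ) (w : Words G (i + 1)),
    proj g i (d G i w) = Pairs.coeff g i * proj g (i + 1) w := by
  intro i
  induction i with
  | zero =>
    intro w
    induction w using FreeAbelianGroup.induction_on with
    | zero => simp
    | neg x hx => rw [map_neg, map_neg, map_neg, hx, mul_neg]
    | add x y hx hy => rw [map_add, map_add, map_add, hx, hy, mul_add]
    | of t =>
      obtain ⟨a, t, rfl⟩ : ∃ a t', t = (Fin.cons a t' : Fin 3 → G) := ⟨t 0, Fin.tail t, by simp⟩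
      rw [← cons_of, d_zero_cons, proj_cons, mul_left_comm, proj, map_sub, lift_apply_of,
        lift_apply_of, lift_apply_of, Pairs.coeff_zero_mul_homotopy hg, mul_sub, of_mul_of,
        of_mul_of]
      simp [ends]
  | succ i ih =>
    intro w
    induction w using FreeAbelianGroup.induction_on with
    | zero => simp
    | neg x hx => rw [map_neg, map_neg, map_neg, hx, mul_neg]
    | add x y hx hy => rw [map_add, map_add, map_add, hx, hy, mul_add]
    | of t =>
      obtain ⟨a, t, rfl⟩ : ∃ a t', t = (Fin.cons a t' : Fin (i + 4) → G) :=
        ⟨t 0, Fin.tail t, by simp⟩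
      rw [← cons_of, d_cons, proj_cons, mul_left_comm, map_sub, proj_scalar_mul, proj_cons, ih,
        ← mul_sub]
      congr 1
      rw [sub_eq_iff_eq_add, Pairs.coeff_mul_homotopy_add hg]

theorem proj_iotaGen [Nontrivial G] {g : G} (hg : orderOf g = Nat.card G) : ∀ i,
    proj g i (iotaGen g i) = 1
  | 0 => (lift_apply_of _ _).trans Pairs.of_one_one
  | 1 => by
    rw [iotaGen, proj_cons, proj_scalar_mul, proj_iotaGen hg 0, Pairs.of_one_one, one_mul]
    have := Pairs.coeff_mul_homotopy_add hg 0 1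
    rwa [← Pairs.of_one_one, Pairs.homotopy_one hg, mul_zero, zero_add] at this
  | i + 2 => by
    rw [iotaGen, proj_cons, proj_scalar_mul, proj_iotaGen hg (i + 1), Pairs.of_one_one, one_mul]
    have := Pairs.coeff_mul_homotopy_add hg (i + 1) 1
    rwa [← Pairs.of_one_one, Pairs.homotopy_one hg, mul_zero, zero_add] at this

/-- The side conditions `h² = 0` and `h (1 ⊗ b) = 0` on the homotopy of the periodic resolution make
the projection descend to the reduced bar resolution. -/
theorem proj_eq_zero [Nontrivial G] {g : G} (hg : orderOf g = Nat.card G) : ∀ (i : ℕ)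
    (t : Fin (i + 2) → G) (m : Fin i), t m.succ.castSucc = 1 → proj g i (of t) = 0
  | i + 1, t, m, hm => by
    rw [proj_succ_of]
    induction m using Fin.cases with
    | zero =>
      have h1 : Fin.tail t 0 = 1 := hm
      match i with
      | 0 =>
        rw [proj, lift_apply_of, h1, Pairs.homotopy_one hg, mul_zero]
      | i + 1 =>
        rw [proj_succ_of, h1, Pairs.of_one_one, one_mul, Pairs.homotopy_homotopy hg, mul_zero]
    | succ m =>
      rw [proj_eq_zero hg i (Fin.tail t) m hm, map_zero, mul_zero]

end Projection

end Words

end Words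

/-! ### The grading by the group -/

/-- The subgroup of `ℤ[α]` spanned by the elements of `s`. -/
def spannedBy {α : Type*} (s : Set α) : AddSubgroup (FreeAbelianGroup α) :=
  AddSubgroup.closure (of '' s)

theorem of_mem_spannedBy {α : Type*} {s : Set α} {x : α} (hx : x ∈ s) : of x ∈ spannedBy s :=
  AddSubgroup.subset_closure ⟨x, hx, rfl⟩

theorem map_mem_of_mem_spannedBy {α M : Type*} [AddCommGroup M] {s : Set α} {K : AddSubgroup M}
    (φ : FreeAbelianGroup α →+ M) (h : ∀ x ∈ s, φ (of x) ∈ K) {w : FreeAbelianGroup α}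
    (hw : w ∈ spannedBy s) : φ w ∈ K := by
  refine (AddSubgroup.closure_le (K.comap φ)).2 ?_ hw
  rintro _ ⟨x, hx, rfl⟩
  exact h x hx

theorem eq_of_mem_spannedBy {α M : Type*} [AddCommGroup M] {s : Set α}
    (φ ψ : FreeAbelianGroup α →+ M) (h : ∀ x ∈ s, φ (of x) = ψ (of x)) {w : FreeAbelianGroup α}
    (hw : w ∈ spannedBy s) : φ w = ψ w := by
  refine (AddSubgroup.closure_le (φ.eqLocus ψ)).2 ?_ hw
  rintro _ ⟨x, hx, rfl⟩
  exact h x hx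

section Degree

variable {G : Type*} [CommGroup G]

/-- The `G`-degree of the generator `1 ⊗ 1` of `P_i`. -/
def genDegree (g : G) (i : ℕ) : G := if Even i then 1 else g

namespace Pairs

/-- The part of `P_i` of `G`-degree `h`. -/
def ofDegree (g : G) (i : ℕ) (h : G) : AddSubgroup (Pairs G) :=
  spannedBy {p | p.1 * p.2 * genDegree g i = h}

theorem of_mul_mem_ofDegree {g : G} {i : ℕ} {h : G} {p : Pairs G} (q : G × G)
    (hp : p ∈ ofDegree g i h) : of q * p ∈ ofDegree g i (q.1 * q.2 * h) := by
  refine map_mem_of_mem_spannedBy (AddMonoidHom.mulLeft (of q)) (fun x hx => ?_) hp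
  rw [AddMonoidHom.coe_mulLeft, of_mul_of]
  refine of_mem_spannedBy ?_
  rw [Set.mem_ofPred_eq] at hx ⊢
  rw [← hx, Prod.fst_mul, Prod.snd_mul, mul_mul_mul_comm q.1, mul_assoc]

theorem geomSum_mem {S : Set (G × G)} {g : G} {n : ℕ}
    (h : ∀ p : G × G, p.1 * p.2 * g = g ^ n → p ∈ S) : geomSum g n ∈ spannedBy S := by
  refine AddSubgroup.sum_mem _ fun l hl => of_mem_spannedBy (h _ ?_)
  have hl := Finset.mem_range.1 hl
  rw [← pow_add, ← pow_succ, show n - 1 - l + l + 1 = n by omega]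

variable [Finite G]

theorem coeff_mem (g : G) (i : ℕ) :
    coeff g i ∈ spannedBy {p | p.1 * p.2 * genDegree g i = genDegree g (i + 1)} := by
  by_cases hi : Even i
  · have hi' : ¬ Even (i + 1) := by simpa [Nat.even_add_one] using hi
    rw [coeff, if_pos hi, genDegree, genDegree, if_pos hi, if_neg hi']
    exact sub_mem (of_mem_spannedBy (by simp)) (of_mem_spannedBy (by simp))
  · have hi' : Even (i + 1) := by simpa [Nat.even_add_one] using hi
    rw [coeff, if_neg hi, genDegree, genDegree, if_neg hi, if_pos hi']
    refine geomSum_mem fun p hp => ?_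
    rw [Set.mem_ofPred_eq, hp, pow_card_eq_one']

theorem homotopy_mem_ofDegree {g : G} (hg : orderOf g = Nat.card G) {i : ℕ} {h : G} {p : Pairs G}
    (hp : p ∈ ofDegree g i h) : homotopy g i p ∈ ofDegree g (i + 1) h := by
  refine map_mem_of_mem_spannedBy _ (fun x hx => ?_) hp
  obtain ⟨x, b⟩ := x
  obtain ⟨n, hn, rfl⟩ := exists_pow_eq hg x
  rw [Set.mem_ofPred_eq] at hx
  subst hx
  by_cases hi : Even i
  · have hi' : ¬ Even (i + 1) := by simpa [Nat.even_add_one] using hi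
    rw [homotopy_even hg hi hn]
    have := of_mul_mem_ofDegree (g := g) (i := i + 1) (h := g ^ n) (1, b) (p := geomSum g n)
      (geomSum_mem fun p hp => by rwa [Set.mem_ofPred_eq, genDegree, if_neg hi'])
    simpa only [genDegree, if_pos hi, mul_one, one_mul, mul_comm (g ^ n)] using this
  · have hi' : Even (i + 1) := by simpa [Nat.even_add_one] using hi
    rw [homotopy_odd g hi]
    split_ifs with h
    · refine of_mem_spannedBy ?_
      rw [Set.mem_ofPred_eq, genDegree, genDegree, if_pos hi', if_neg hi, mul_right_comm (g ^ n), h,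
        mul_one]
    · exact zero_mem _

end Pairs

namespace Words

theorem prod_ends (i : ℕ) (p : G × G) : ∏ m, ends i p m = p.1 * p.2 := by
  rw [Fin.prod_univ_succ, Fin.prod_univ_castSucc]
  have (m : Fin i) : (m : ℕ) ≠ i := m.2.ne
  simp [ends, this]

variable [Finite G]

theorem iotaGen_mem (g : G) : ∀ i, iotaGen g i ∈ spannedBy {t | ∏ m, t m = genDegree g i}
  | 0 => of_mem_spannedBy (by simp [genDegree])
  | i + 1 => by
    refine map_mem_of_mem_spannedBy ((cons 1).comp (AddMonoidHom.mulLeft _)) (fun t ht => ?_)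
      (iotaGen_mem g i)
    refine map_mem_of_mem_spannedBy ((cons 1).comp
      ((AddMonoidHom.mulRight (of t)).comp (scalar G i).toAddMonoidHom)) (fun p hp => ?_)
      (Pairs.coeff_mem g i)
    change cons 1 (scalar G i (of p) * of t) ∈ _
    rw [scalar_of, of_mul_of, cons_of]
    refine of_mem_spannedBy ?_
    rw [Set.mem_ofPred_eq] at hp ht ⊢
    rw [Fin.prod_cons, one_mul, ← hp, ← ht, ← prod_ends i p, ← Finset.prod_mul_distrib]
    rfl

theorem proj_mem {g : G} (hg : orderOf g = Nat.card G) : ∀ (i : ℕ) (t : Fin (i + 2) → G),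
    proj g i (of t) ∈ Pairs.ofDegree g i (∏ m, t m)
  | 0, t => by
    rw [proj, lift_apply_of]
    exact of_mem_spannedBy (by simp [genDegree])
  | i + 1, t => by
    have := Pairs.of_mul_mem_ofDegree (t 0, 1)
      (Pairs.homotopy_mem_ofDegree hg (proj_mem hg i (Fin.tail t)))
    rw [proj_succ_of, Fin.prod_univ_succ]
    rw [mul_one] at this
    exact this

end Words

end Degree

/-! ### Closed formulas for the comparison maps -/

section Formulas

variable {G : Type*} [CommGroup G]

/-- The word `(1, x₁, …, xᵢ, b)`, which stands for `1 ⊗ x₁ ⊗ ⋯ ⊗ xᵢ ⊗ b`. -/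
def word {i : ℕ} (x : Fin i → G) (b : G) : Fin (i + 2) → G := Fin.cons 1 (Fin.snoc x b)

namespace Words

theorem ends_mul_word {i : ℕ} (a c : G) (x : Fin i → G) (b : G) :
    ends i (a, c) * word x b = Fin.cons a (Fin.snoc x (c * b)) := by
  funext m
  refine Fin.cases ?_ (fun m => ?_) m
  · simp [ends, word]
  · refine Fin.lastCases ?_ (fun m => ?_) m
    · simp [ends, word]
    · have := m.2.ne
      simp [ends, word, this]

theorem cons_ends_mul_word {i : ℕ} (a c : G) (x : Fin i → G) (b : G) :
    (Fin.cons 1 (ends i (a, c) * word x b) : Fin (i + 3) → G) = word (Fin.cons a x) (c * b) := by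
  rw [ends_mul_word, word, Fin.cons_snoc_eq_snoc_cons]

variable {M : Type*} [AddCommGroup M]

/-- `φ` vanishes on the words with an inner letter `1`, that is, it factors through the reduced bar
resolution. -/
def IsReduced {i : ℕ} (φ : Words G i →+ M) : Prop :=
  ∀ (t : Fin (i + 2) → G) (m : Fin i), t m.succ.castSucc = 1 → φ (of t) = 0

theorem IsReduced.cons_word_one {i : ℕ} {φ : Words G (i + 1) →+ M} (hφ : IsReduced φ)
    (x : Fin i → G) (b : G) : φ (of (word (Fin.cons 1 x) b)) = 0 := by
  refine hφ _ 0 ?_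
  rw [word, Fin.cons_snoc_eq_snoc_cons]
  rfl

/-- Reducedness passes through the recursive step `w ↦ 1 ⊗ p w` that defines `iotaGen`. -/
theorem IsReduced.comp {i : ℕ} {φ : Words G (i + 1) →+ M} (hφ : IsReduced φ) (p : Pairs G) :
    IsReduced (φ.comp ((cons 1).comp (AddMonoidHom.mulLeft (scalar G i p)))) := by
  intro t m hm
  change φ (cons 1 (scalar G i p * of t)) = 0
  induction p using FreeAbelianGroup.induction_on with
  | zero => simp
  | neg x hx => rw [map_neg, neg_mul, map_neg, map_neg, hx, neg_zero]
  | add x y hx hy => rw [map_add, add_mul, map_add, map_add, hx, hy, add_zero]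
  | of p =>
    rw [scalar_of, of_mul_of, cons_of]
    refine hφ _ m.succ ?_
    have h1 := m.2.ne
    rw [← Fin.succ_castSucc, Fin.cons_succ, Pi.mul_apply, hm]
    simp [ends, h1]

section Inclusion

variable [Finite G]

/-- The exponents `(i₁, …, iₖ)` over which the values of the inclusion are summed. -/
abbrev exponents (G : Type*) (k : ℕ) : Finset (Fin k → ℕ) :=
  Fintype.piFinset fun _ : Fin k => Finset.Icc 1 (Nat.card G - 1)

theorem sum_exponents_succ (k : ℕ) (f : (Fin (k + 1) → ℕ) → M) :
    ∑ e ∈ exponents G (k + 1), f e =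
      ∑ e ∈ exponents G k, ∑ n ∈ Finset.Icc 1 (Nat.card G - 1), f (Fin.snoc e n) := by
  rw [← Finset.sum_product']
  refine Finset.sum_bij' (fun e _ => (Fin.init e, e (Fin.last k))) (fun q _ => Fin.snoc q.1 q.2)
    ?_ ?_ ?_ ?_ ?_
  · intro e he
    rw [Fintype.mem_piFinset] at he
    exact Finset.mem_product.2 ⟨Fintype.mem_piFinset.2 fun m => he _, he _⟩
  · intro q hq
    have hq := Finset.mem_product.1 hq
    refine Fintype.mem_piFinset.2 fun m => Fin.lastCases ?_ (fun m => ?_) m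
    · simpa using hq.2
    · simpa using Fintype.mem_piFinset.1 hq.1 m
  · simp
  · simp
  · simp

theorem sum_exponents_le {k : ℕ} {e : Fin k → ℕ} (he : e ∈ exponents G k) :
    ∑ m, e m + k ≤ k * Nat.card G := by
  have hpos : 0 < Nat.card G := Nat.card_pos
  calc ∑ m, e m + k = ∑ m, (e m + 1) := by simp [Finset.sum_add_distrib]
    _ ≤ ∑ _m : Fin k, Nat.card G := Finset.sum_le_sum fun m _ => by
        have := Finset.mem_Icc.1 (Fintype.mem_piFinset.1 he m)
        omega
    _ = k * Nat.card G := by simp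

theorem evenWord_snoc (g : G) {k : ℕ} (e : Fin k → ℕ) (n : ℕ) :
    (evenWord g (Fin.snoc e n : Fin (k + 1) → ℕ) : Fin (2 * k + 1 + 1) → G) =
      Fin.cons (g ^ n) (oddWord g e) := by
  funext m
  refine Fin.cases ?_ (fun m => Fin.cases ?_ (fun m => ?_) m) m
  · have : Fin.rev (0 : Fin (k + 1)) = Fin.last k := by simp
    simp [evenWord, this]
  · simp [evenWord, oddWord]
  · simp only [Fin.cons_succ, oddWord, evenWord, Fin.val_succ]
    rw [show ((m : ℕ) + 1 + 1) % 2 = m % 2 by omega]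
    refine if_congr Iff.rfl ?_ rfl
    have hm : (m : ℕ) < 2 * k := m.2
    have h : Fin.rev (⟨((m : ℕ) + 1 + 1) / 2, by omega⟩ : Fin (k + 1)) =
        (Fin.rev (⟨(m : ℕ) / 2, by omega⟩ : Fin k)).castSucc := by
      ext
      simp only [Fin.val_rev, Fin.val_castSucc]
      omega
    rw [h, Fin.snoc_castSucc]

/-- The value of the inclusion in an even degree passes on to the next degree: of the two terms of
`d(1 ⊗ 1) = g ⊗ 1 - 1 ⊗ g` only the first contributes. -/
theorem iotaGen_odd_of_even (g : G) (k : ℕ)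
    (h : ∀ φ : Words G (2 * k) →+ M, IsReduced φ →
      φ (iotaGen g (2 * k)) = ∑ e ∈ exponents G k,
        φ (of (word (evenWord g e) (g ^ (k * Nat.card G - (∑ m, e m) - k)))))
    (φ : Words G (2 * k + 1) →+ M) (hφ : IsReduced φ) :
    φ (iotaGen g (2 * k + 1)) = ∑ e ∈ exponents G k,
      φ (of (word (oddWord g e) (g ^ (k * Nat.card G - (∑ m, e m) - k)))) := by
  refine (h _ (hφ.comp (Pairs.coeff g (2 * k)))).trans (Finset.sum_congr rfl fun e _ => ?_)
  change φ (cons 1 (scalar G _ _ * of _)) = _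
  rw [Pairs.coeff, if_pos (even_two_mul k), map_sub, scalar_of, scalar_of, sub_mul, of_mul_of,
    of_mul_of, map_sub, cons_of, cons_of, cons_ends_mul_word, cons_ends_mul_word, map_sub,
    hφ.cons_word_one, sub_zero, one_mul]
  rfl

theorem iotaGen_even (g : G) : ∀ (k : ℕ) (φ : Words G (2 * k) →+ M),
    IsReduced φ → φ (iotaGen g (2 * k)) = ∑ e ∈ exponents G k,
      φ (of (word (evenWord g e) (g ^ (k * Nat.card G - (∑ m, e m) - k))))
  | 0, φ, _ => by
    have (e : Fin 0 → ℕ) : (1 : Fin 2 → G) = word (evenWord g e) 1 := by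
      funext m
      fin_cases m <;> rfl
    simp only [exponents, Fintype.piFinset_of_isEmpty, Finset.univ_unique, Finset.sum_singleton,
      zero_mul, Nat.zero_sub, pow_zero, ← this]
    rfl
  | k + 1, φ, hφ => by
    refine (iotaGen_odd_of_even g k (iotaGen_even g k) _
      (IsReduced.comp (i := 2 * k + 1) hφ (Pairs.coeff g (2 * k + 1)))).trans ?_
    rw [sum_exponents_succ]
    refine Finset.sum_congr rfl fun e he => ?_
    have hle := sum_exponents_le he
    have hpos : 0 < Nat.card G := Nat.card_pos
    change φ (cons 1 (scalar G _ _ * of _)) = _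
    rw [Pairs.coeff, if_neg (by simp), Pairs.geomSum, map_sum, Finset.sum_mul, map_sum, map_sum,
      ← Finset.sum_range_reflect]
    symm
    refine (Finset.sum_congr rfl fun n hn => ?_).trans (Finset.sum_subset
      (fun n hn => Finset.mem_range.2 (by have := Finset.mem_Icc.1 hn; omega)) fun n hn hn' => ?_)
    · have hn := Finset.mem_Icc.1 hn
      rw [scalar_of, of_mul_of, cons_of, cons_ends_mul_word, ← pow_add,
        show Nat.card G - 1 - (Nat.card G - 1 - n) = n by omega]
      have hw := evenWord_snoc g e n
      have he : (k + 1) * Nat.card G - ∑ m, (Fin.snoc e n : Fin (k + 1) → ℕ) m - (k + 1) =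
          Nat.card G - 1 - n + (k * Nat.card G - ∑ m, e m - k) := by
        rw [Fin.sum_univ_castSucc, add_mul]
        simp only [Fin.snoc_castSucc, Fin.snoc_last]
        omega
      rw [he]
      exact congrArg (fun x => φ (of (word x _))) hw
    · -- the exponent `0` gives a word with an inner letter `1`
      have : n = 0 := by
        have := Finset.mem_range.1 hn
        rw [Finset.mem_Icc] at hn'
        omega
      rw [scalar_of, of_mul_of, cons_of, cons_ends_mul_word, this, Nat.sub_zero, Nat.sub_self,
        pow_zero]
      exact IsReduced.cons_word_one (i := 2 * k + 1) hφ _ _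

end Inclusion

section Projection

variable [Finite G]

theorem proj_word_cons (g : G) {i : ℕ} (a : G) (x : Fin i → G) (b : G) :
    proj g (i + 1) (of (word (Fin.cons a x) b)) =
      Pairs.homotopy g i (of (a, 1) * proj g i (of (word x b))) := by
  rw [← proj_scalar_mul, scalar_of, of_mul_of, ← one_mul b, ← cons_ends_mul_word, ← cons_of,
    proj_cons, Pairs.of_one_one, one_mul, one_mul]

theorem proj_odd_of_even {g : G} (hg : orderOf g = Nat.card G) {k : ℕ} (e : Fin (2 * k + 1) → ℕ)
    (he : ∀ m, e m < Nat.card G)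
    (h : proj g (2 * k) (of (word (fun m : Fin (2 * k) => g ^ e m.succ) 1)) =
      if ∀ r : Fin k, Nat.card G ≤ e ⟨2 * r + 1, by omega⟩ + e ⟨2 * r + 2, by omega⟩ then
        of (1, ∏ r : Fin k, g ^ (e ⟨2 * r + 1, by omega⟩ + e ⟨2 * r + 2, by omega⟩ - Nat.card G))
      else 0) :
    proj g (2 * k + 1) (of (word (fun m => g ^ e m) 1)) =
      if ∀ r : Fin k, Nat.card G ≤ e ⟨2 * r + 1, by omega⟩ + e ⟨2 * r + 2, by omega⟩ then
        of (1, ∏ r : Fin k, g ^ (e ⟨2 * r + 1, by omega⟩ + e ⟨2 * r + 2, by omega⟩ - Nat.card G)) *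
          Pairs.geomSum g (e 0)
      else 0 := by
  have hc : (fun m => g ^ e m) = (Fin.cons (g ^ e 0) fun m : Fin (2 * k) => g ^ e m.succ :
      Fin (2 * k + 1) → G) := by
    funext m
    refine Fin.cases rfl (fun m => rfl) m
  rw [hc, proj_word_cons, h]
  split_ifs
  · rw [of_mul_of, Prod.mk_mul_mk, mul_one, one_mul, Pairs.homotopy_even hg (even_two_mul k) (he 0)]
  · rw [mul_zero, map_zero]

theorem proj_even {g : G} (hg : orderOf g = Nat.card G) : ∀ (k : ℕ) (e : Fin (2 * k) → ℕ)
    (_ : ∀ m, e m < Nat.card G),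
    proj g (2 * k) (of (word (fun m => g ^ e m) 1)) =
      if ∀ r : Fin k, Nat.card G ≤ e ⟨2 * r, by omega⟩ + e ⟨2 * r + 1, by omega⟩ then
        of (1, ∏ r : Fin k, g ^ (e ⟨2 * r, by omega⟩ + e ⟨2 * r + 1, by omega⟩ - Nat.card G))
      else 0
  | 0, e, _ => by
    rw [if_pos fun r => r.elim0]
    exact lift_apply_of _ _
  | k + 1, e, he => by
    have hc : (fun m => g ^ e m) = (Fin.cons (g ^ e 0) fun m : Fin (2 * k + 1) => g ^ e m.succ :
        Fin (2 * k + 1 + 1) → G) := by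
      funext m
      refine Fin.cases rfl (fun m => rfl) m
    have h : proj g (2 * k + 1) (of (word (fun m => g ^ e m.succ) 1)) =
        if ∀ r : Fin k, Nat.card G ≤ e ⟨2 * r + 1 + 1, by omega⟩ + e ⟨2 * r + 2 + 1, by omega⟩ then
          of (1, ∏ r : Fin k,
            g ^ (e ⟨2 * r + 1 + 1, by omega⟩ + e ⟨2 * r + 2 + 1, by omega⟩ - Nat.card G)) *
              Pairs.geomSum g (e 1)
        else 0 :=
      proj_odd_of_even hg (fun m : Fin (2 * k + 1) => e m.succ) (fun m => he _)
        (proj_even hg k (fun m => e m.succ.succ) fun m => he _)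
    refine (congrArg (fun x => proj g (2 * k + 1 + 1) (of (word x 1))) hc).trans ?_
    rw [proj_word_cons, h]
    have hiff : (∀ r : Fin (k + 1), Nat.card G ≤ e ⟨2 * r, by omega⟩ + e ⟨2 * r + 1, by omega⟩) ↔
        Nat.card G ≤ e 0 + e 1 ∧ ∀ r : Fin k, Nat.card G ≤
          e ⟨2 * r + 1 + 1, by omega⟩ + e ⟨2 * r + 2 + 1, by omega⟩ :=
      Fin.forall_fin_succ
    rw [if_congr hiff rfl rfl, Fin.prod_univ_succ]
    by_cases h2 : ∀ r : Fin k, Nat.card G ≤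
        e ⟨2 * r + 1 + 1, by omega⟩ + e ⟨2 * r + 2 + 1, by omega⟩
    · rw [if_pos h2, ← mul_assoc, of_mul_of, Prod.mk_mul_mk, mul_one, one_mul,
        Pairs.homotopy_odd_mul_geomSum hg (by simp) (he 0) (he _).le]
      exact if_congr (and_iff_left h2).symm rfl rfl
    · rw [if_neg h2, mul_zero, map_zero, if_neg fun h => h2 h.2]

end Projection

end Words

end Formulas

/-! ### From the group to the skew group algebra -/

section Transfer

variable {F G V : Type*} [Field F] [CommGroup G] [AddCommGroup V] [Module F V]
  [DistribMulAction G V] [SMulCommClass G F V]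

section Homs

variable {N N' : Type*} [AddCommGroup N] [Module F N] [Module (Ae F G V) N]
  [IsScalarTower F (Ae F G V) N] [SMulCommClass F (Ae F G V) N]
  [AddCommGroup N'] [Module F N'] [Module (Ae F G V) N']
  [IsScalarTower F (Ae F G V) N'] [SMulCommClass F (Ae F G V) N']

/-- `twist a b` as an additive map. -/
def twistHom {j : ℕ} (a b : G) : (⋀[F]^j V →ₗ[F] N) →+ (⋀[F]^j V →ₗ[F] N) :=
  AddMonoidHom.ofMapSub (twist a b) (twist_sub a b)

/-- `koszul c` as an additive map. -/
def koszulHom {j : ℕ} (c : V →ₗ[F] Ae F G V) :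
    (⋀[F]^j V →ₗ[F] N) →+ (⋀[F]^(j + 1) V →ₗ[F] N) :=
  AddMonoidHom.ofMapSub (koszul c) (koszul_sub c)

/-- Composition with a map of bimodules, as an additive map. -/
def compHom {W : Type*} [AddCommGroup W] [Module F W] (D : N →ₗ[Ae F G V] N') :
    (W →ₗ[F] N) →+ (W →ₗ[F] N') :=
  AddMonoidHom.mk' (fun R => D.restrictScalars F ∘ₗ R) fun _ _ => LinearMap.comp_add _ _ _

end Homs

variable (F V) in
/-- The map which sends the pair `(a', a)` to `y ↦ a' ⊗ ᵃy ⊗ a`, with values in `X_{i,j}`. -/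
def X.eval (i j : ℕ) : Pairs G →+ (⋀[F]^j V →ₗ[F] X F G V i j) :=
  lift fun p => X.elt i j p.1 p.2

variable (F V) in
/-- The map which sends the word `t` to `y ↦ t₀ ⊗ t₁ ⊗ ⋯ ⊗ tᵢ ⊗ ᵃy ⊗ a`, where `a = tᵢ₊₁`, with
values in `Y_{i,j}`. -/
def Y.eval (i j : ℕ) : Words G i →+ (⋀[F]^j V →ₗ[F] Y F G V i j) :=
  lift (Y.elt F V j)

theorem X.eval_of (i j : ℕ) (p : G × G) : X.eval F V i j (of p) = X.elt i j p.1 p.2 :=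
  lift_apply_of _ _

theorem Y.eval_of (i j : ℕ) (t : Fin (i + 2) → G) : Y.eval F V i j (of t) = Y.elt F V j t :=
  lift_apply_of _ _

theorem X.eval_one (i j : ℕ) : X.eval F V i j (1 : Pairs G) = X.gen i j := by
  rw [← Pairs.of_one_one, X.eval_of, X.elt, twist_one]

theorem X.eval_of_mul (i j : ℕ) (p : G × G) (q : Pairs G) :
    X.eval F V i j (of p * q) = twist p.1 p.2 (X.eval F V i j q) := by
  refine DFunLike.congr_fun (lift_ext (β := ⋀[F]^j V →ₗ[F] X F G V i j)
    ((X.eval F V i j).comp (AddMonoidHom.mulLeft (of p)))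
    ((twistHom p.1 p.2).comp (X.eval F V i j)) fun q => ?_) q
  change X.eval F V i j (of p * of q) = twist p.1 p.2 (X.eval F V i j (of q))
  rw [of_mul_of, X.eval_of, X.eval_of, X.elt, X.elt, twist_twist, mul_comm q.2]
  rfl

theorem Y.elt_ends_mul {i : ℕ} (j : ℕ) (p : G × G) (t : Fin (i + 2) → G) :
    Y.elt F V j (Words.ends i p * t) = twist p.1 p.2 (Y.elt F V j t) := by
  have h (m : Fin i) : (m : ℕ) ≠ i := m.2.ne
  rw [Y.elt, Y.elt, twist_twist]
  simp [Words.ends, h, mul_comm p.2]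

theorem Y.eval_scalar_of_mul (i j : ℕ) (p : G × G) (w : Words G i) :
    Y.eval F V i j (Words.scalar G i (of p) * w) = twist p.1 p.2 (Y.eval F V i j w) := by
  refine DFunLike.congr_fun (lift_ext (β := ⋀[F]^j V →ₗ[F] Y F G V i j)
    ((Y.eval F V i j).comp (AddMonoidHom.mulLeft (Words.scalar G i (of p))))
    ((twistHom p.1 p.2).comp (Y.eval F V i j)) fun t => ?_) w
  change Y.eval F V i j (Words.scalar G i (of p) * of t) = twist p.1 p.2 (Y.eval F V i j (of t))
  rw [Words.scalar_of, of_mul_of, Y.eval_of, Y.eval_of, Y.elt_ends_mul]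

theorem Y.elt_word {i : ℕ} (j : ℕ) (x : Fin i → G) (b : G) :
    Y.elt F V j (word x b) = twist 1 b (Y.gen F V j x) := by
  rw [Y.elt, word]
  simp [← Fin.succ_last]

theorem Y.eval_word {i : ℕ} (j : ℕ) (x : Fin i → G) :
    Y.eval F V i j (of (word x 1)) = Y.gen F V j x := by
  rw [Y.eval_of, Y.elt_word, twist_one]

theorem Y.eval_isReduced (i j : ℕ) : 
    Words.IsReduced (M := ⋀[F]^j V →ₗ[F] Y F G V i j) (Y.eval F V i j) := by
  intro t m hm
  have : Y.gen F V j (fun q : Fin i => t q.succ.castSucc) = 0 := by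
    unfold Y.gen
    rw [bar_eq_zero (F := F) _ m hm]
    ext; simp
  rw [Y.eval_of, Y.elt, this]
  exact map_zero (twistHom _ _)

theorem Y.dB_eval (i j : ℕ) (w : Words G (i + 1)) :
    (Y.dB F G V i j).restrictScalars F ∘ₗ Y.eval F V (i + 1) j w =
      Y.eval F V i j (Words.d G i w) := by
  refine DFunLike.congr_fun (lift_ext (β := ⋀[F]^j V →ₗ[F] Y F G V i j)
    ((compHom (Y.dB F G V i j)).comp (Y.eval F V (i + 1) j))
    ((Y.eval F V i j).comp (Words.d G i)) fun t => ?_) w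
  change (Y.dB F G V i j).restrictScalars F ∘ₗ Y.eval F V (i + 1) j (of t) =
    Y.eval F V i j (Words.d G i (of t))
  rw [Y.eval_of, Y.dB_elt, Words.d_of, map_sum]
  exact Finset.sum_congr rfl fun k _ => by rw [map_zsmul, Y.eval_of]

theorem Y.dK_eval (i j : ℕ) {h : G} {w : Words G i} (hw : w ∈ spannedBy {t | ∏ m, t m = h}) :
    (Y.dK F G V i j).restrictScalars F ∘ₗ Y.eval F V i (j + 1) w =
      koszul (koszulCoeff F V h) (Y.eval F V i j w) := by
  refine eq_of_mem_spannedBy (M := ⋀[F]^(j + 1) V →ₗ[F] Y F G V i j)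
    ((compHom (Y.dK F G V i j)).comp (Y.eval F V i (j + 1)))
    ((koszulHom (koszulCoeff F V h)).comp (Y.eval F V i j)) (fun t ht => ?_) hw
  change (Y.dK F G V i j).restrictScalars F ∘ₗ Y.eval F V i (j + 1) (of t) =
    koszul _ (Y.eval F V i j (of t))
  rw [Set.mem_ofPred_eq] at ht
  rw [Y.eval_of, Y.eval_of, Y.dK_elt, ht]

theorem X.dK_eval (g : G) (i j : ℕ) {h : G} {p : Pairs G} (hp : p ∈ Pairs.ofDegree g i h) :
    (X.dK F V g i j).restrictScalars F ∘ₗ X.eval F V i (j + 1) p =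
      koszul (koszulCoeff F V h) (X.eval F V i j p) := by
  refine eq_of_mem_spannedBy (M := ⋀[F]^(j + 1) V →ₗ[F] X F G V i j)
    ((compHom (X.dK F V g i j)).comp (X.eval F V i (j + 1)))
    ((koszulHom (koszulCoeff F V h)).comp (X.eval F V i j)) (fun q hq => ?_) hp
  change (X.dK F V g i j).restrictScalars F ∘ₗ X.eval F V i (j + 1) (of q) =
    koszul _ (X.eval F V i j (of q))
  rw [Set.mem_ofPred_eq] at hq
  rw [X.eval_of, X.eval_of, X.elt, X.elt, map_twist, X.dK_gen, ← koszul_twist, ← hq,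
    mul_right_comm, genDegree]

theorem X.dP_gen_eq_eval [Finite G] (g : G) (i j : ℕ) :
    (X.dP F V g i j).restrictScalars F ∘ₗ X.gen (i + 1) j = X.eval F V i j (Pairs.coeff g i) := by
  rw [X.dP_gen, Pairs.coeff]
  split_ifs
  · rw [map_sub, X.eval_of, X.eval_of]
  · rw [Pairs.geomSum, map_sum]
    refine Finset.sum_congr rfl fun l _ => ?_
    rw [X.eval_of]

theorem X.dP_eval [Finite G] (g : G) (i j : ℕ) (p : Pairs G) :
    (X.dP F V g i j).restrictScalars F ∘ₗ X.eval F V (i + 1) j p =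
      X.eval F V i j (Pairs.coeff g i * p) := by
  refine DFunLike.congr_fun (lift_ext (β := ⋀[F]^j V →ₗ[F] X F G V i j)
    ((compHom (X.dP F V g i j)).comp (X.eval F V (i + 1) j))
    ((X.eval F V i j).comp (AddMonoidHom.mulLeft (Pairs.coeff g i))) fun q => ?_) p
  change (X.dP F V g i j).restrictScalars F ∘ₗ X.eval F V (i + 1) j (of q) =
    X.eval F V i j (Pairs.coeff g i * of q)
  rw [X.eval_of, X.elt, map_twist, X.dP_gen_eq_eval, mul_comm, X.eval_of_mul]

section Inclusion

variable [Finite G]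

variable (F V) in
/-- The map `ι_{i,j} : X_{i,j} → Y_{i,j}`. -/
def inclusion (g : G) (i j : ℕ) : X F G V i j →ₗ[Ae F G V] Y F G V i j :=
  extend (Y.eval F V i j (Words.iotaGen g i))

theorem inclusion_gen (g : G) (i j : ℕ) :
    (inclusion F V g i j).restrictScalars F ∘ₗ X.gen i j = Y.eval F V i j (Words.iotaGen g i) :=
  extend_comp_mk _

theorem inclusion_eval (g : G) (i j : ℕ) (p : Pairs G) :
    (inclusion F V g i j).restrictScalars F ∘ₗ X.eval F V i j p =
      Y.eval F V i j (Words.scalar G i p * Words.iotaGen g i) := by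
  refine DFunLike.congr_fun (lift_ext (β := ⋀[F]^j V →ₗ[F] Y F G V i j)
    ((compHom (inclusion F V g i j)).comp (X.eval F V i j))
    ((Y.eval F V i j).comp ((AddMonoidHom.mulRight (Words.iotaGen g i)).comp
      (Words.scalar G i).toAddMonoidHom)) fun q => ?_) p
  change (inclusion F V g i j).restrictScalars F ∘ₗ X.eval F V i j (of q) =
    Y.eval F V i j (Words.scalar G i (of q) * Words.iotaGen g i)
  rw [X.eval_of, X.elt, map_twist, inclusion_gen, Y.eval_scalar_of_mul]

theorem inclusion_comp_dP (g : G) (i j : ℕ) :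
    inclusion F V g i j ∘ₗ X.dP F V g i j = Y.dB F G V i j ∘ₗ inclusion F V g (i + 1) j := by
  apply X.ext
  change (inclusion F V g i j).restrictScalars F ∘ₗ
      ((X.dP F V g i j).restrictScalars F ∘ₗ X.gen (i + 1) j) =
    (Y.dB F G V i j).restrictScalars F ∘ₗ
      ((inclusion F V g (i + 1) j).restrictScalars F ∘ₗ X.gen (i + 1) j)
  rw [X.dP_gen_eq_eval, inclusion_eval, inclusion_gen, Y.dB_eval, Words.d_iotaGen]

theorem inclusion_comp_dK (g : G) (i j : ℕ) :
    inclusion F V g i j ∘ₗ X.dK F V g i j = Y.dK F G V i j ∘ₗ inclusion F V g i (j + 1) := by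
  apply X.ext
  change (inclusion F V g i j).restrictScalars F ∘ₗ
      ((X.dK F V g i j).restrictScalars F ∘ₗ X.gen i (j + 1)) =
    (Y.dK F G V i j).restrictScalars F ∘ₗ
      ((inclusion F V g i (j + 1)).restrictScalars F ∘ₗ X.gen i (j + 1))
  rw [X.dK_gen, map_koszul, inclusion_gen, inclusion_gen, Y.dK_eval i j (Words.iotaGen_mem g i),
    genDegree]

end Inclusion

section Projection

variable [Finite G] [Nontrivial G]

variable (F V) in
/-- The map `π_{i,j} : Y_{i,j} → X_{i,j}`. -/
def projection (g : G) (i j : ℕ) : Y F G V i j →ₗ[Ae F G V] X F G V i j :=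
  extend (onTuples fun x => X.eval F V i j (Words.proj g i (of (word x 1))))

theorem projection_gen {g : G} (hg : orderOf g = Nat.card G) (i j : ℕ) (x : Fin i → G) :
    (projection F V g i j).restrictScalars F ∘ₗ Y.gen F V j x =
      X.eval F V i j (Words.proj g i (of (word x 1))) := by
  unfold Y.gen projection
  rw [← LinearMap.comp_assoc, extend_comp_mk, onTuples_bar]
  intro x m hm
  rw [Words.proj_eq_zero hg i _ m, map_zero]
  rw [word, ← Fin.succ_castSucc, Fin.cons_succ, Fin.snoc_castSucc, hm]

theorem projection_eval {g : G} (hg : orderOf g = Nat.card G) (i j : ℕ) (w : Words G i) :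
    (projection F V g i j).restrictScalars F ∘ₗ Y.eval F V i j w =
      X.eval F V i j (Words.proj g i w) := by
  refine DFunLike.congr_fun (lift_ext (β := ⋀[F]^j V →ₗ[F] X F G V i j)
    ((compHom (projection F V g i j)).comp (Y.eval F V i j))
    ((X.eval F V i j).comp (Words.proj g i)) fun t => ?_) w
  change (projection F V g i j).restrictScalars F ∘ₗ Y.eval F V i j (of t) =
    X.eval F V i j (Words.proj g i (of t))
  have ht : t = Words.ends i (t 0, t (Fin.last _)) * word (fun m => t m.succ.castSucc) 1 := by
    rw [Words.ends_mul_word, mul_one]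
    funext m
    refine Fin.cases rfl (fun m => Fin.lastCases ?_ (fun m => ?_) m) m
    · simp
    · simp
  conv_rhs => rw [ht, of_mul, ← Words.scalar_of, Words.proj_scalar_mul, X.eval_of_mul]
  rw [Y.eval_of, Y.elt, map_twist, projection_gen hg]

theorem projection_comp_dB {g : G} (hg : orderOf g = Nat.card G) (i j : ℕ) :
    projection F V g i j ∘ₗ Y.dB F G V i j = X.dP F V g i j ∘ₗ projection F V g (i + 1) j := by
  apply Y.ext
  intro x
  change (projection F V g i j).restrictScalars F ∘ₗ
      ((Y.dB F G V i j).restrictScalars F ∘ₗ Y.gen F V j x) =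
    (X.dP F V g i j).restrictScalars F ∘ₗ
      ((projection F V g (i + 1) j).restrictScalars F ∘ₗ Y.gen F V j x)
  rw [projection_gen hg, X.dP_eval, ← Words.proj_d hg, ← projection_eval hg, ← Y.dB_eval,
    Y.eval_word]

theorem projection_comp_dK {g : G} (hg : orderOf g = Nat.card G) (i j : ℕ) :
    projection F V g i j ∘ₗ Y.dK F G V i j = X.dK F V g i j ∘ₗ projection F V g i (j + 1) := by
  apply Y.ext
  intro x
  change (projection F V g i j).restrictScalars F ∘ₗ
      ((Y.dK F G V i j).restrictScalars F ∘ₗ Y.gen F V (j + 1) x) =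
    (X.dK F V g i j).restrictScalars F ∘ₗ
      ((projection F V g i (j + 1)).restrictScalars F ∘ₗ Y.gen F V (j + 1) x)
  have hx : ∏ m, word x 1 m = ∏ m, x m := by
    rw [word, Fin.prod_cons, Fin.prod_snoc, one_mul, mul_one]
  have h := Words.proj_mem hg i (word x 1)
  rw [hx] at h
  rw [Y.dK_gen, map_koszul, projection_gen hg, projection_gen hg, X.dK_eval g i j h]

theorem projection_comp_inclusion {g : G} (hg : orderOf g = Nat.card G) (i j : ℕ) :
    projection F V g i j ∘ₗ inclusion F V g i j = LinearMap.id := by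
  apply X.ext
  change (projection F V g i j).restrictScalars F ∘ₗ
    ((inclusion F V g i j).restrictScalars F ∘ₗ X.gen i j) = X.gen i j
  rw [inclusion_gen, projection_eval hg, Words.proj_iotaGen hg, X.eval_one]

end Projection

end Transfer

/-! ### Maps of total complexes -/

section TotMap

variable {R : Type*} [Ring R] {M M' M'' : ℕ → ℕ → Type*} [∀ i j, AddCommGroup (M i j)]
  [∀ i j, Module R (M i j)] [∀ i j, AddCommGroup (M' i j)] [∀ i j, Module R (M' i j)]

/-- The map of total complexes induced by a map of double complexes. -/
def Tot.map (φ : ∀ i j, M i j →ₗ[R] M' i j) (n : ℕ) : Tot M n →ₗ[R] Tot M' n :=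
  DirectSum.toModule R _ _ fun p => Tot.incl p.2 ∘ₗ φ p.1.1 p.1.2

theorem Tot.map_comp_incl (φ : ∀ i j, M i j →ₗ[R] M' i j) {i j n : ℕ} (h : i + j = n) :
    Tot.map φ n ∘ₗ Tot.incl h = Tot.incl h ∘ₗ φ i j :=
  LinearMap.ext fun x => DirectSum.toModule_lof R (ι := {p : ℕ × ℕ // p.1 + p.2 = n})
    (M := fun p => M p.1.1 p.1.2) (φ := fun p => Tot.incl p.2 ∘ₗ φ p.1.1 p.1.2) ⟨(i, j), h⟩ x

theorem Tot.ext {N : Type*} [AddCommGroup N] [Module R N] {n : ℕ} {D D' : Tot M n →ₗ[R] N}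
    (h : ∀ i j (h : i + j = n), D ∘ₗ Tot.incl (M := M) h = D' ∘ₗ Tot.incl h) : D = D' :=
  DirectSum.linearMap_ext R fun p => h p.1.1 p.1.2 p.2

theorem Tot.map_comp_d (φ : ∀ i j, M i j →ₗ[R] M' i j)
    (dh : ∀ i j, M (i + 1) j →ₗ[R] M i j) (dv : ∀ i j, M i (j + 1) →ₗ[R] M i j)
    (dh' : ∀ i j, M' (i + 1) j →ₗ[R] M' i j) (dv' : ∀ i j, M' i (j + 1) →ₗ[R] M' i j)
    (hh : ∀ i j, φ i j ∘ₗ dh i j = dh' i j ∘ₗ φ (i + 1) j)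
    (hv : ∀ i j, φ i j ∘ₗ dv i j = dv' i j ∘ₗ φ i (j + 1)) (n : ℕ) :
    Tot.map φ n ∘ₗ Tot.d dh dv n = Tot.d dh' dv' n ∘ₗ Tot.map φ (n + 1) := by
  refine Tot.ext fun i j h => ?_
  rw [LinearMap.comp_assoc, LinearMap.comp_assoc, Tot.d_incl, Tot.map_comp_incl,
    ← LinearMap.comp_assoc, Tot.d_incl, LinearMap.comp_add, LinearMap.add_comp,
    LinearMap.comp_smul, LinearMap.smul_comp]
  congr 2
  · cases i with
    | zero => simp [Tot.horiz]
    | succ i =>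
      rw [Tot.horiz, Tot.horiz, ← LinearMap.comp_assoc, Tot.map_comp_incl, LinearMap.comp_assoc,
        hh, LinearMap.comp_assoc]
  · cases j with
    | zero => cases i <;> simp [Tot.vert]
    | succ j =>
      -- the equations of `Tot.vert` reduce only after a case split on its first index
      have e1 : Tot.vert dv i (j + 1) h = Tot.incl (show i + j = n by omega) ∘ₗ dv i j := by
        cases i <;> rfl
      have e2 : Tot.vert dv' i (j + 1) h = Tot.incl (show i + j = n by omega) ∘ₗ dv' i j := by
        cases i <;> rfl
      rw [e1, e2, ← LinearMap.comp_assoc, Tot.map_comp_incl, LinearMap.comp_assoc,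
        hv, LinearMap.comp_assoc]

end TotMap

/-! ### Values on tensors -/

section Values

variable {F G V : Type*} [Field F] [CommGroup G] [AddCommGroup V] [Module F V]
  [DistribMulAction G V] [SMulCommClass G F V]

theorem lr_one_one : lr F G V 1 1 = 1 := rfl

theorem X.elt_apply (i j : ℕ) (a' a : G) (y : ⋀[F]^j V) :
    X.elt i j a' a y = lr F G V (grp F V a') (grp F V a) ⊗ₜ[F] extAct F V j a y := by
  rw [X.elt, twist_apply]
  exact (TensorProduct.smul_tmul' _ _ _).trans (by rw [smul_eq_mul, mul_one])

theorem Y.elt_apply {i : ℕ} (j : ℕ) (t : Fin (i + 2) → G) (y : ⋀[F]^j V) :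
    Y.elt F V j t y = lr F G V (grp F V (t 0)) (grp F V (t (Fin.last _))) ⊗ₜ[F]
      (bar F (fun m => t m.succ.castSucc) ⊗ₜ[F] extAct F V j (t (Fin.last _)) y) := by
  rw [Y.elt, twist_apply]
  exact (TensorProduct.smul_tmul' _ _ _).trans (by rw [smul_eq_mul, mul_one]; rfl)

theorem Y.eval_word_apply {i : ℕ} (j : ℕ) (x : Fin i → G) (b : G) (y : ⋀[F]^j V) :
    Y.eval F V i j (of (word x b)) y =
      lr F G V 1 (grp F V b) ⊗ₜ[F] (bar F x ⊗ₜ[F] extAct F V j b y) := by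
  rw [Y.eval_of, Y.elt_word, twist_apply]
  exact (TensorProduct.smul_tmul' _ _ _).trans (by rw [smul_eq_mul, mul_one, grp_one]; rfl)

theorem smul_mem_symPow (h : G) {p : ℕ} {s : SymmetricAlgebra F V} (hs : s ∈ symPow F V p) :
    h • s ∈ symPow F V p := by
  have hle : (symPow F V p).map (symAct F G V h).toLinearMap ≤ symPow F V p := by
    rw [symPow, Submodule.map_pow]
    refine pow_le_pow_left' ?_ p
    rintro _ ⟨_, ⟨v, rfl⟩, rfl⟩
    exact ⟨h • v, (smul_ι h v).symm⟩
  exact hle ⟨s, hs, rfl⟩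

theorem lr_mon_mul_lr_grp (r s : SymmetricAlgebra F V) (a' a b' b : G) :
    lr F G V (mon r a') (mon s a) * lr F G V (grp F V b') (grp F V b) =
      lr F G V (mon r (a' * b')) (mon (b • s) (b * a)) := by
  rw [lr_mul, grp, grp, mon_mul, mon_mul, smul_one, mul_one, one_mul]

end Values

/-! ### Homogeneity -/

section Homogeneous

variable {F : Type*} {G : Type*} {V : Type*} [Field F] [CommGroup G] [AddCommGroup V] [Module F V]
  [DistribMulAction G V] [SMulCommClass G F V] [Finite G]

theorem YComplex.incl_smul_eval_mem {i j n p q d : ℕ} (hn : i + j = n) (hd : p + j + q = d)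
    {r s : SymmetricAlgebra F V} (hr : r ∈ symPow F V p) (hs : s ∈ symPow F V q) (a' a h : G)
    {w : Words G i} (hw : w ∈ spannedBy {t | ∏ m, t m = h}) (y : ⋀[F]^j V) :
    Tot.incl (R := Ae F G V) (M := Y F G V) hn
      (lr F G V (mon r a') (mon s a) • Y.eval F V i j w y) ∈
        YComplex.homog F V n d (a' * h * a) := by
  refine map_mem_of_mem_spannedBy (K := (YComplex.homog F V n d (a' * h * a)).toAddSubgroup)
    (AddMonoidHom.mk' (fun w => Tot.incl (R := Ae F G V) (M := Y F G V) hn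
      (lr F G V (mon r a') (mon s a) • Y.eval F V i j w y)) fun w w' => ?_) (fun t ht => ?_) hw
  · rw [map_add, LinearMap.add_apply, smul_add, map_add]
  · rw [Set.mem_ofPred_eq] at ht
    refine Submodule.subset_span ⟨i, j, p, q, hn, r, t (Fin.last _) • s, a' * t 0,
      t (Fin.last _) * a, fun m => t m.succ.castSucc, extAct F V j (t (Fin.last _)) y, hr,
      smul_mem_symPow _ hs, hd, ?_, ?_⟩
    · rw [← ht, Fin.prod_univ_succ, Fin.prod_univ_castSucc]
      simp only [mul_assoc, Fin.succ_last, Fin.succ_castSucc]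
    · refine congrArg (Tot.incl (R := Ae F G V) (M := Y F G V) hn) ?_
      rw [Y.eval_of, Y.elt_apply, TensorProduct.smul_tmul', smul_eq_mul, lr_mon_mul_lr_grp]

theorem XComplex.incl_smul_eval_mem (g : G) {i j n p q d : ℕ} (hn : i + j = n) (hd : p + j + q = d)
    {r s : SymmetricAlgebra F V} (hr : r ∈ symPow F V p) (hs : s ∈ symPow F V q) (a' a h : G)
    {w : Pairs G} (hw : w ∈ Pairs.ofDegree g i h) (y : ⋀[F]^j V) :
    Tot.incl (R := Ae F G V) (M := X F G V) hn
      (lr F G V (mon r a') (mon s a) • X.eval F V i j w y) ∈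
        XComplex.homog F V g n d (a' * h * a) := by
  refine map_mem_of_mem_spannedBy (K := (XComplex.homog F V g n d (a' * h * a)).toAddSubgroup)
    (AddMonoidHom.mk' (fun w => Tot.incl (R := Ae F G V) (M := X F G V) hn
      (lr F G V (mon r a') (mon s a) • X.eval F V i j w y)) fun w w' => ?_) (fun t ht => ?_) hw
  · rw [map_add, LinearMap.add_apply, smul_add, map_add]
  · rw [Set.mem_ofPred_eq] at ht
    refine Submodule.subset_span ⟨i, j, p, q, hn, r, t.2 • s, a' * t.1, t.2 * a,
      extAct F V j t.2 y, hr, smul_mem_symPow _ hs, hd, ?_, ?_⟩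
    · rw [← ht, genDegree]
      simp only [mul_assoc, mul_comm a]
    · refine congrArg (Tot.incl (R := Ae F G V) (M := X F G V) hn) ?_
      rw [X.eval_of, X.elt_apply, TensorProduct.smul_tmul', smul_eq_mul, lr_mon_mul_lr_grp]

end Homogeneous

/-! ### The chain maps between the twisted complexes -/

section Complexes

open CategoryTheory

variable {F : Type*} {G : Type*} {V : Type*} [Field F] [CommGroup G] [AddCommGroup V] [Module F V]
  [DistribMulAction G V] [SMulCommClass G F V] [Finite G]

theorem XComplex.d_eq (g : G) (n : ℕ) : (XComplex F V g).d (n + 1) n =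
    ModuleCat.ofHom (Tot.d (X.dP F V g) (X.dK F V g) n) :=
  ChainComplex.of_d (fun n => ModuleCat.of (Ae F G V) (Tot (X F G V) n))
    (fun n => ModuleCat.ofHom (Tot.d (X.dP F V g) (X.dK F V g) n)) n

theorem YComplex.d_eq (n : ℕ) : (YComplex F G V).d (n + 1) n =
    ModuleCat.ofHom (Tot.d (Y.dB F G V) (Y.dK F G V) n) :=
  ChainComplex.of_d (fun n => ModuleCat.of (Ae F G V) (Tot (Y F G V) n))
    (fun n => ModuleCat.ofHom (Tot.d (Y.dB F G V) (Y.dK F G V) n)) n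

variable (F V) in
/-- The chain map `ι : X → Y`. -/
def inclusionMap (g : G) : XComplex F V g ⟶ YComplex F G V :=
  ChainComplex.ofHom (fun n => ModuleCat.ofHom (Tot.map (inclusion F V g) n)) fun n => by
    rw [XComplex.d_eq, YComplex.d_eq]
    exact (ModuleCat.ofHom_comp _ _).symm.trans ((congrArg ModuleCat.ofHom (Tot.map_comp_d _ _ _ _ _
      (inclusion_comp_dP g) (inclusion_comp_dK g) n).symm).trans (ModuleCat.ofHom_comp _ _))

theorem inclusionMap_tensor (g : G) {i j n : ℕ} (h : i + j = n) (a : A F G V) (y : ⋀[F]^j V)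
    (b : A F G V) : ((inclusionMap F V g).f n).hom (XComplex.tensor g h a y b) =
      Tot.incl (R := Ae F G V) (M := Y F G V) h
        (lr F G V a b • Y.eval F V i j (Words.iotaGen g i) y) := by
  refine (LinearMap.congr_fun (Tot.map_comp_incl (inclusion F V g) h) _).trans ?_
  refine congrArg (Tot.incl (R := Ae F G V) (M := Y F G V) h) ?_
  have : lr F G V a b ⊗ₜ[F] y = lr F G V a b • X.gen (F := F) (G := G) (V := V) i j y :=
    ((TensorProduct.smul_tmul' _ _ _).trans (by rw [smul_eq_mul, mul_one])).symm
  rw [this, map_smul, ← inclusion_gen]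
  rfl

theorem inclusionMap_homog (g : G) (n d : ℕ) (a : G) (z : Tot (X F G V) n)
    (hz : z ∈ XComplex.homog F V g n d a) :
    ((inclusionMap F V g).f n).hom z ∈ YComplex.homog F V n d a := by
  suffices h : XComplex.homog F V g n d a ≤ (YComplex.homog F V n d a).comap
      ((Tot.map (inclusion F V g) n).restrictScalars F) from h hz
  refine Submodule.span_le.2 ?_
  rintro _ ⟨i, j, p, q, hn, r, s, a', b, y, hr, hs, hd, rfl, rfl⟩
  have := YComplex.incl_smul_eval_mem hn hd hr hs a' b _ (Words.iotaGen_mem g i) y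
  rw [← inclusionMap_tensor, genDegree, mul_right_comm] at this
  exact this

section Projection

variable [Nontrivial G]

variable (F V) in
/-- The chain map `π : Y → X`. -/
def projectionMap {g : G} (hg : orderOf g = Nat.card G) : YComplex F G V ⟶ XComplex F V g :=
  ChainComplex.ofHom (fun n => ModuleCat.ofHom (Tot.map (projection F V g) n)) fun n => by
    rw [XComplex.d_eq, YComplex.d_eq]
    exact (ModuleCat.ofHom_comp _ _).symm.trans ((congrArg ModuleCat.ofHom (Tot.map_comp_d _ _ _ _ _
      (projection_comp_dB hg) (projection_comp_dK hg) n).symm).trans (ModuleCat.ofHom_comp _ _))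

theorem projectionMap_tensor {g : G} (hg : orderOf g = Nat.card G) {i j n : ℕ} (h : i + j = n)
    (a : A F G V) (x : Fin i → G) (y : ⋀[F]^j V) (b : A F G V) :
    ((projectionMap F V hg).f n).hom (YComplex.tensor h a x y b) =
      Tot.incl (R := Ae F G V) (M := X F G V) h
        (lr F G V a b • X.eval F V i j (Words.proj g i (of (word x 1))) y) := by
  refine (LinearMap.congr_fun (Tot.map_comp_incl (projection F V g) h) _).trans ?_
  refine congrArg (Tot.incl (R := Ae F G V) (M := X F G V) h) ?_
  have : lr F G V a b ⊗ₜ[F] (bar F x ⊗ₜ[F] y) =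
      lr F G V a b • Y.gen (F := F) (G := G) (V := V) j x y :=
    ((TensorProduct.smul_tmul' _ _ _).trans (by rw [smul_eq_mul, mul_one]; rfl)).symm
  rw [this, map_smul, ← projection_gen hg]
  rfl

theorem projectionMap_homog {g : G} (hg : orderOf g = Nat.card G) (n d : ℕ) (a : G)
    (z : Tot (Y F G V) n) (hz : z ∈ YComplex.homog F V n d a) :
    ((projectionMap F V hg).f n).hom z ∈ XComplex.homog F V g n d a := by
  suffices h : YComplex.homog F V n d a ≤ (XComplex.homog F V g n d a).comap
      ((Tot.map (projection F V g) n).restrictScalars F) from h hz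
  refine Submodule.span_le.2 ?_
  rintro _ ⟨i, j, p, q, hn, r, s, a', b, x, y, hr, hs, hd, rfl, rfl⟩
  have := XComplex.incl_smul_eval_mem g hn hd hr hs a' b _ (Words.proj_mem hg i (word x 1)) y
  rw [← projectionMap_tensor hg, word, Fin.prod_cons, Fin.prod_snoc, one_mul, mul_one] at this
  exact this

theorem inclusionMap_comp_projectionMap {g : G} (hg : orderOf g = Nat.card G) :
    inclusionMap F V g ≫ projectionMap F V hg = 𝟙 (XComplex F V g) := by
  ext n : 1
  refine ModuleCat.hom_ext ?_
  change Tot.map (projection F V g) n ∘ₗ Tot.map (inclusion F V g) n = LinearMap.id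
  refine Tot.ext fun i j h => ?_
  rw [LinearMap.comp_assoc, Tot.map_comp_incl, ← LinearMap.comp_assoc, Tot.map_comp_incl,
    LinearMap.comp_assoc, projection_comp_inclusion hg]
  rfl

end Projection

/-- The evaluation of words at `y`, placed in the total complex. -/
def YComplex.wordHom {i j n : ℕ} (h : i + j = n) (y : ⋀[F]^j V) : Words G i →+ Tot (Y F G V) n :=
  AddMonoidHom.mk' (fun w => Tot.incl (R := Ae F G V) (M := Y F G V) h (Y.eval F V i j w y))
    fun w w' => by rw [map_add, LinearMap.add_apply, map_add]

theorem YComplex.wordHom_isReduced {i j n : ℕ} (h : i + j = n) (y : ⋀[F]^j V) :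
    Words.IsReduced (YComplex.wordHom (G := G) h y) := by
  intro t m hm
  change Tot.incl (R := Ae F G V) (M := Y F G V) h (Y.eval F V i j (of t) y) = 0
  rw [Y.eval_isReduced i j t m hm, LinearMap.zero_apply, map_zero]

theorem YComplex.wordHom_word {i j n : ℕ} (h : i + j = n) (y : ⋀[F]^j V) (x : Fin i → G) (b : G) :
    YComplex.wordHom h y (of (word x b)) =
      YComplex.tensor h 1 x (extAct F V j b y) (grp F V b) :=
  congrArg (Tot.incl (R := Ae F G V) (M := Y F G V) h) (Y.eval_word_apply j x b y)

theorem inclusionMap_tensor_one (g : G) {i j n : ℕ} (h : i + j = n) (y : ⋀[F]^j V) :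
    ((inclusionMap F V g).f n).hom (XComplex.tensor g h 1 y 1) =
      YComplex.wordHom h y (Words.iotaGen g i) := by
  rw [inclusionMap_tensor, lr_one_one, one_smul]
  rfl

end Complexes

end TwistedKoszul

end

theorem mainTheorem6 {F : Type*} {G : Type*} {V : Type*} [Field F] [CommGroup G]
    [AddCommGroup V] [Module F V] [FiniteDimensional F V] [DistribMulAction G V]
    [SMulCommClass G F V] [Finite G] [Nontrivial G] (hF : ringChar F ≠ 2)
    (g : G) (hg : ∀ x : G, x ∈ Subgroup.zpowers g) :
    ∃ (ι : XComplex F V g ⟶ YComplex F G V) (π : YComplex F G V ⟶ XComplex F V g),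
      -- the values of `ι` on `1 ⊗ y ⊗ 1` in `X_{2k,j}` and in `X_{2k+1,j}`
      (∀ (k j n : ℕ) (h : 2 * k + j = n) (y : ⋀[F]^j V),
        (ι.f n).hom (XComplex.tensor g h 1 y 1) =
          ∑ e ∈ Fintype.piFinset fun _ : Fin k => Finset.Icc 1 (Nat.card G - 1),
            YComplex.tensor h 1 (evenWord g e)
              (extAct F V j (g ^ (k * Nat.card G - (∑ m, e m) - k)) y)
              (grp F V (g ^ (k * Nat.card G - (∑ m, e m) - k)))) ∧
      (∀ (k j n : ℕ) (h : 2 * k + 1 + j = n) (y : ⋀[F]^j V),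
        (ι.f n).hom (XComplex.tensor g h 1 y 1) =
          ∑ e ∈ Fintype.piFinset fun _ : Fin k => Finset.Icc 1 (Nat.card G - 1),
            YComplex.tensor h 1 (oddWord g e)
              (extAct F V j (g ^ (k * Nat.card G - (∑ m, e m) - k)) y)
              (grp F V (g ^ (k * Nat.card G - (∑ m, e m) - k)))) ∧
      -- the values of `π` on `1 ⊗ g^{e₀} ⊗ ⋯ ⊗ y ⊗ 1` in `Y_{2k,j}` and in `Y_{2k+1,j}`
      (∀ (k j n : ℕ) (h : 2 * k + j = n) (e : Fin (2 * k) → ℕ) (_ : ∀ m, e m < Nat.card G)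
          (y : ⋀[F]^j V) (β : G)
          (_ : β = ∏ r : Fin k,
            g ^ (e ⟨2 * r, by omega⟩ + e ⟨2 * r + 1, by omega⟩ - Nat.card G)),
        (π.f n).hom (YComplex.tensor h 1 (fun m => g ^ e m) y 1) =
          if ∀ r : Fin k, Nat.card G ≤ e ⟨2 * r, by omega⟩ + e ⟨2 * r + 1, by omega⟩ then
            XComplex.tensor g h 1 (extAct F V j β y) (grp F V β)
          else 0) ∧
      (∀ (k j n : ℕ) (h : 2 * k + 1 + j = n) (e : Fin (2 * k + 1) → ℕ)
          (_ : ∀ m, e m < Nat.card G) (y : ⋀[F]^j V) (β : G)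
          (_ : β = ∏ r : Fin k,
            g ^ (e ⟨2 * r + 1, by omega⟩ + e ⟨2 * r + 2, by omega⟩ - Nat.card G)),
        (π.f n).hom (YComplex.tensor h 1 (fun m => g ^ e m) y 1) =
          if ∀ r : Fin k, Nat.card G ≤ e ⟨2 * r + 1, by omega⟩ + e ⟨2 * r + 2, by omega⟩ then
            ∑ l ∈ Finset.range (e 0),
              XComplex.tensor g h (grp F V (g ^ (e 0 - 1 - l))) (extAct F V j (g ^ l * β) y)
                (grp F V (g ^ l * β))
          else 0) ∧
      -- `ι` and `π` are homogeneous of degree zero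
      (∀ (n d : ℕ) (a : G) (z : Tot (X F G V) n), z ∈ XComplex.homog F V g n d a →
        (ι.f n).hom z ∈ YComplex.homog F V n d a) ∧
      (∀ (n d : ℕ) (a : G) (z : Tot (Y F G V) n), z ∈ YComplex.homog F V n d a →
        (π.f n).hom z ∈ XComplex.homog F V g n d a) ∧
      ι ≫ π = 𝟙 (XComplex F V g) := by
  have hord : orderOf g = Nat.card G := orderOf_eq_card_of_forall_mem_zpowers hg
  refine ⟨inclusionMap F V g, projectionMap F V hord, ?_, ?_, ?_, ?_, inclusionMap_homog g,
    projectionMap_homog hord, inclusionMap_comp_projectionMap hord⟩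
  · intro k j n h y
    rw [inclusionMap_tensor_one, Words.iotaGen_even g k _ (YComplex.wordHom_isReduced h y)]
    exact Finset.sum_congr rfl fun e _ => YComplex.wordHom_word h y _ _
  · intro k j n h y
    rw [inclusionMap_tensor_one, Words.iotaGen_odd_of_even g k (Words.iotaGen_even g k) _
      (YComplex.wordHom_isReduced h y)]
    exact Finset.sum_congr rfl fun e _ => YComplex.wordHom_word h y _ _
  · rintro k j n h e he y _ rfl
    rw [projectionMap_tensor, lr_one_one, one_smul, Words.proj_even hord k e he]
    split_ifs
    · rw [X.eval_of, X.elt_apply, grp_one]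
      rfl
    · rw [map_zero, LinearMap.zero_apply, map_zero]
      rfl
  · rintro k j n h e he y _ rfl
    rw [projectionMap_tensor, lr_one_one, one_smul,
      Words.proj_odd_of_even hord e he (Words.proj_even hord k _ fun m => he _)]
    split_ifs
    · rw [Pairs.geomSum, Finset.mul_sum, map_sum, LinearMap.sum_apply, map_sum]
      refine Finset.sum_congr rfl fun l _ => ?_
      rw [FreeAbelianGroup.of_mul_of, X.eval_of, X.elt_apply, Prod.mk_mul_mk, one_mul,
        mul_comm (g ^ l)]
      rfl
    · rw [map_zero, LinearMap.zero_apply, map_zero]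
      rfl
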